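/- Let $p$ be a prime, let $R$ be a commutative complete local Noetherian ring, $X=\operatorname{spf}(R)$, and let $F$ be a commutative one-dimensional formal group law over $R$ whose reduction modulo the maximal ideal of $R$ has finite height $n\ge 1$ at $p$ (that is, the reduction of $[p]_F(x)$ has leading term in degree $p^n$). Let $\mathbb G=\operatorname{spf}(R[[x]])$ be the formal group over $X$ with coordinate $x$ and addition $F$. For $d\ge 0$ let $\mathrm{Div}_d^+(\mathbb G)=\mathbb G^d/\Sigma_d$ be the scheme of effective divisors of degree $d$ on $\mathbb G$; its coordinate ring is $R[[x_1,\dots,x_d]]^{\Sigma_d}=R[[c_1,\dots,c_d]]$, where $c_k$ is the coefficient of $t^{d-k}$ in $\prod_i(t-x_i)$. For $k\ge 0$ let $\psi^k$ be the self-map of $\mathrm{Div}_d^+(\mathbb G)$ induced by $k\colon\mathbb G\to\mathbb G$. For $v,m\ge 0$ put $\mathbb G(v)=\ker(p^v\colon\mathbb G\to\mathbb G)=\operatorname{spf}(R[[x]]/[p^v](x))$ and $\mathbb G(v,m)=\operatorname{spf}(R[[x]]/[p^v](x)^m)$. If $Y$ is $\operatorname{spf}$ of an $R$-algebra $\mathcal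 O_Y$ that is free of finite rank, let $Y^d/\Sigma_d$ be $\operatorname{spf}$ of the ring of symmetric tensors $(\mathcal O_Y^{\otimes_R d})^{\Sigma_d}$. Finally, let $Z(v,d)$ be the closed subscheme of $\mathrm{Div}_d^+(\mathbb G)$ of divisors $D$ with $\psi^{p^v}D=d[0]$. Then for all $v,d\ge 0$: (a) $Z(v,d)$ is finite and flat over $X$, of degree $p^{ndv}$. (b) There are closed inclusions \[ \mathbb G(v)^d/\Sigma_d \to Z(v,d) \to \mathbb G(v,d)^d/\Sigma_d \to \mathrm{Div}_d^+(\mathbb G), \] where the maps to $\mathrm{Div}_d^+(\mathbb G)$ are the inclusion of $Z(v,d)$ and the maps induced by the $d$-fold powers of the inclusions of $\mathbb G(v)$ and $\mathbb G(v,d)$ in $\mathbb G$. The first two are infinitesimal thickenings: the corresponding maps of rings are surjective with nilpotent kernel. (c) If $R$ is a field, then it has characteristic $p$, and $Z(v,d)$ is the fibre, over the divisor $d[0]$, of the $nv$-fold relative Frobenius map \[ \mathrm{Div}_d^+(\mathbb G)\to \mathrm{Div}_d^+((F_X^{nv})^*\mathbb G), \] where $F_X$ denotes the absolute Frobenius map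 of $X$; so \[ \mathcal O_{Z(v,d)}=R[[c_1,\dots,c_d]]/(c_1^{p^{nv}},\dots,c_d^{p^{nv}}). \] -/

import Mathlib

open scoped TensorProduct

noncomputable section

namespace FormalGroup

variable {R : Type*} [CommRing R]

/-- The coordinate `x`, as a point of `𝔾` with values in `R⟦x⟧`. -/
def coordPoint (F : FormalGroup R) : F.Point Unit :=
  ⟨PowerSeries.X, PowerSeries.HasSubst.X'⟩

/-- The series `[k]_F(x)`: the `k`-fold sum of the coordinate `x` under the formal group law. -/
def mulSeries (F : FormalGroup R) (k : ℕ) : PowerSeries R :=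
  (k • F.coordPoint).val

lemma mulSeries_hasSubst (F : FormalGroup R) (k : ℕ) : PowerSeries.HasSubst (F.mulSeries k) :=
  (k • F.coordPoint).property

/-- A formal group law over a field has height `n` at `p` if `[p]_F(x)` has leading term in
degree `p ^ n`. -/
def HasHeight {k : Type*} [Field k] (F : FormalGroup k) (p n : ℕ) : Prop :=
  (F.mulSeries p).order = ((p ^ n : ℕ) : ℕ∞)

/-! ### Divisors

`𝔾 = Spf R⟦x⟧` is the formal group with coordinate `x` and addition `F`, so that `𝔾^d` has
coordinate ring `R⟦x_1, …, x_d⟧`. -/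

/-- The coordinate ring of `Div_d^+(𝔾) = 𝔾^d/Σ_d`: the invariants of `Σ_d` acting on
`R⟦x_1, …, x_d⟧` by permuting the variables. -/
def divRing (_F : FormalGroup R) (d : ℕ) : Subalgebra R (MvPowerSeries (Fin d) R) where
  carrier := {f | ∀ σ : Equiv.Perm (Fin d), MvPowerSeries.renameEquiv R σ f = f}
  mul_mem' hf hg σ := by rw [map_mul, hf σ, hg σ]
  add_mem' hf hg σ := by rw [map_add, hf σ, hg σ]
  algebraMap_mem' r σ := AlgEquiv.commutes _ r

/-- The polynomial `∏ i, (t - x_i)` in `t` with coefficients in `R⟦x_1, …, x_d⟧`. -/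
def divPoly (R : Type*) [CommRing R] (d : ℕ) : Polynomial (MvPowerSeries (Fin d) R) :=
  ∏ i : Fin d, (Polynomial.X - Polynomial.C (MvPowerSeries.X i))

/-- The coordinate functions `c_1, …, c_d` on `Div_d^+(𝔾)`: `c_k` is the coefficient of
`t ^ (d - k)` in `∏ i, (t - x_i)`. The index `j : Fin d` stands for `k = j + 1`. -/
def chern (F : FormalGroup R) (d : ℕ) (j : Fin d) : F.divRing d :=
  ⟨(divPoly R d).coeff (d - (j + 1)), by
    intro σ
    have h : (divPoly R d).map (MvPowerSeries.rename σ).toRingHom = divPoly R d := by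
      rw [divPoly, Polynomial.map_prod, ← Equiv.prod_comp σ
        fun i => Polynomial.X - Polynomial.C (MvPowerSeries.X i : MvPowerSeries (Fin d) R)]
      refine Finset.prod_congr rfl fun i _ => ?_
      simp
    change (MvPowerSeries.rename σ).toRingHom _ = _
    rw [← Polynomial.coeff_map, h]⟩

/-- The coordinates `x_i` pulled back along `k : 𝔾 → 𝔾`, namely `[k]_F(x_i)`. -/
def mulCoord (F : FormalGroup R) (k d : ℕ) (i : Fin d) : MvPowerSeries (Fin d) R :=
  (F.mulSeries k).subst (MvPowerSeries.X i : MvPowerSeries (Fin d) R)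

lemma mulCoord_hasSubst (F : FormalGroup R) (k d : ℕ) :
    MvPowerSeries.HasSubst (F.mulCoord k d) :=
  MvPowerSeries.hasSubst_of_constantCoeff_nilpotent fun i =>
    MvPowerSeries.IsNilpotent_subst (PowerSeries.HasSubst.X i).const (F.mulSeries_hasSubst k)

/-- The ring map of `k^d : 𝔾^d → 𝔾^d`, sending `f(x_1, …, x_d)` to
`f([k]_F(x_1), …, [k]_F(x_d))`. -/
def mulPull (F : FormalGroup R) (k d : ℕ) :
    MvPowerSeries (Fin d) R →ₐ[R] MvPowerSeries (Fin d) R :=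
  MvPowerSeries.substAlgHom (F.mulCoord_hasSubst k d)

lemma mulPull_mem (F : FormalGroup R) (k d : ℕ) {f : MvPowerSeries (Fin d) R}
    (hf : f ∈ F.divRing d) : F.mulPull k d f ∈ F.divRing d := by
  intro σ
  have key : (fun i => (F.mulCoord k d i).subst
      ((MvPowerSeries.X : Fin d → MvPowerSeries (Fin d) R) ∘ σ)) = F.mulCoord k d ∘ σ := by
    funext i
    rw [mulCoord, PowerSeries.subst, MvPowerSeries.subst_comp_subst_apply
      (PowerSeries.HasSubst.X i).const (MvPowerSeries.HasSubst.X_comp (f := σ))]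
    simp only [Function.comp_apply, mulCoord, PowerSeries.subst]
    congr 1
    funext _
    exact MvPowerSeries.subst_X (MvPowerSeries.HasSubst.X_comp (f := σ)) i
  have hfσ : f.subst ((MvPowerSeries.X : Fin d → MvPowerSeries (Fin d) R) ∘ σ) = f := by
    rw [← MvPowerSeries.rename_eq_subst]
    exact hf σ
  change MvPowerSeries.rename σ (F.mulPull k d f) = F.mulPull k d f
  rw [MvPowerSeries.rename_eq_subst, mulPull, MvPowerSeries.substAlgHom_apply,
    MvPowerSeries.subst_comp_subst_apply (F.mulCoord_hasSubst k d)
      (MvPowerSeries.HasSubst.X_comp (f := σ)), key]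
  conv_rhs => rw [← hfσ]
  rw [MvPowerSeries.subst_comp_subst_apply (MvPowerSeries.HasSubst.X_comp (f := σ))
    (F.mulCoord_hasSubst k d)]
  congr 1
  funext i
  exact (MvPowerSeries.subst_X (F.mulCoord_hasSubst k d) (σ i)).symm

/-- The ring map of `ψ^k : Div_d^+(𝔾) → Div_d^+(𝔾)`, the map induced by `k : 𝔾 → 𝔾`. -/
def psi (F : FormalGroup R) (k d : ℕ) : F.divRing d →ₐ[R] F.divRing d :=
  ((F.mulPull k d).comp (F.divRing d).val).codRestrict (F.divRing d)
    fun f => F.mulPull_mem k d f.2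

/-- The ring map of the section `d[0] : X → Div_d^+(𝔾)`, the image of `(0, …, 0)`. -/
def zeroDiv (F : FormalGroup R) (d : ℕ) : F.divRing d →ₐ[R] R :=
  { (MvPowerSeries.constantCoeff (σ := Fin d) (R := R)).comp
      (F.divRing d).val.toRingHom with
    commutes' := fun r => by
      change MvPowerSeries.constantCoeff (algebraMap R (MvPowerSeries (Fin d) R) r) = r
      simp [MvPowerSeries.algebraMap_apply] }

/-- The ideal of the closed subscheme `Z(v, d)` of `Div_d^+(𝔾)` (for the given prime `p`): it is
generated by the elements that express the equation `ψ^{p^v} D = d[0]`. -/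
def zIdeal (F : FormalGroup R) (p v d : ℕ) : Ideal (F.divRing d) :=
  Ideal.span (Set.range fun f : F.divRing d =>
    F.psi (p ^ v) d f - algebraMap R (F.divRing d) (F.zeroDiv d f))

/-- The coordinate ring of the scheme `Z(v, d)` of divisors `D` with `ψ^{p^v} D = d[0]`. -/
abbrev zRing (F : FormalGroup R) (p v d : ℕ) : Type _ := F.divRing d ⧸ F.zIdeal p v d

/-- A point `D` of `Div_d^+(𝔾)` with values in an `R`-algebra `A` lies in `Z(v, d)` if and only
if `ψ^{p^v} D = d[0]`. -/
lemma zIdeal_le_ker_iff (F : FormalGroup R) (p v d : ℕ) {A : Type*} [CommRing A] [Algebra R A]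
    (D : F.divRing d →ₐ[R] A) :
    F.zIdeal p v d ≤ RingHom.ker D ↔
      D.comp (F.psi (p ^ v) d) = (Algebra.ofId R A).comp (F.zeroDiv d) := by
  rw [zIdeal, Ideal.span_le, Set.range_subset_iff, AlgHom.ext_iff]
  refine forall_congr' fun f => ?_
  simp [RingHom.mem_ker, sub_eq_zero, Algebra.ofId_apply]

/-! ### Torsion subschemes and symmetric powers -/

/-- The ideal `([p^v]_F(x))` of the subgroup scheme `𝔾(v) = ker(p^v : 𝔾 → 𝔾)` of `𝔾`. The ideal
of `𝔾(v, m)`, which is `m` times the divisor `𝔾(v)`, is its `m`-th power. -/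
def torsionIdeal (F : FormalGroup R) (p v : ℕ) : Ideal (PowerSeries R) :=
  Ideal.span {F.mulSeries (p ^ v)}

end FormalGroup

/-- The symmetric tensors in the `d`-th tensor power of `B` over `R`: the coordinate ring of
`Y^d/Σ_d`, where `B` is the coordinate ring of `Y`. -/
def symTensors (R B : Type*) [CommRing R] [CommRing B] [Algebra R B] (d : ℕ) :
    Subalgebra R (⨂[R] _ : Fin d, B) where
  carrier := {t | ∀ σ : Equiv.Perm (Fin d), PiTensorProduct.reindex R (fun _ => B) σ t = t}
  mul_mem' {a b} ha hb σ := by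
    have hmul : ∀ x y : ⨂[R] _ : Fin d, B,
        PiTensorProduct.reindex R (fun _ => B) σ (x * y) =
          PiTensorProduct.reindex R (fun _ => B) σ x *
            PiTensorProduct.reindex R (fun _ => B) σ y := by
      intro x y
      induction x using PiTensorProduct.induction_on with
      | smul_tprod r f =>
        induction y using PiTensorProduct.induction_on with
        | smul_tprod s g =>
          simp only [smul_mul_assoc, mul_smul_comm, map_smul, PiTensorProduct.tprod_mul_tprod,
            PiTensorProduct.reindex_tprod]
          rfl
        | add x y hx hy => rw [mul_add, map_add, map_add, mul_add, hx, hy]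
      | add x y hx hy => rw [add_mul, map_add, map_add, add_mul, hx, hy]
    rw [hmul, ha σ, hb σ]
  add_mem' ha hb σ := by rw [map_add, ha σ, hb σ]
  algebraMap_mem' r σ := by
    rw [Algebra.algebraMap_eq_smul_one, map_smul, PiTensorProduct.one_def,
      PiTensorProduct.reindex_tprod]
    rfl

/-- For the closed subscheme `Y` of `𝔾 = Spf R⟦x⟧` with ideal `I`, this says that `θ` is the ring
map of the `d`-fold product `Y^d → 𝔾^d` of the inclusion: its `i`-th component is the inclusion
of the `i`-th factor, that is, `θ (g(x_i)) = 1 ⊗ ⋯ ⊗ g ⊗ ⋯ ⊗ 1` (with `g` in place `i`). -/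
def IsPowerOfInclusion {R : Type*} [CommRing R] (I : Ideal (PowerSeries R)) (d : ℕ)
    (θ : MvPowerSeries (Fin d) R →ₐ[R] ⨂[R] _ : Fin d, (PowerSeries R ⧸ I)) : Prop :=
  ∀ (i : Fin d) (g : PowerSeries R),
    θ (g.subst (MvPowerSeries.X i : MvPowerSeries (Fin d) R)) =
      PiTensorProduct.singleAlgHom (R := R) (A := fun _ : Fin d => PowerSeries R ⧸ I) i
        (Ideal.Quotient.mk I g)

/-! ### Relative Frobenius -/

namespace FormalGroup

variable {R : Type*} [CommRing R]

/-- The formal group `(F_X^N)^* 𝔾`, the pullback of `𝔾` along the `N`-fold absolute Frobenius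
of the base. -/
abbrev frobTwist (F : FormalGroup R) (p N : ℕ) [ExpChar R p] : FormalGroup R :=
  F.map (iterateFrobenius R p N)

/-- The ring map of the projection
`Div_d^+((F_X^N)^* 𝔾) = (F_X^N)^* Div_d^+(𝔾) → Div_d^+(𝔾)`: it raises the coefficients to the
power `p ^ N`. -/
def frobProj (F : FormalGroup R) (p N d : ℕ) [ExpChar R p] :
    F.divRing d →+* (F.frobTwist p N).divRing d :=
  ((MvPowerSeries.map (iterateFrobenius R p N)).comp (F.divRing d).val.toRingHom).codRestrict
    ((F.frobTwist p N).divRing d) fun f σ => by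
      have h : MvPowerSeries.rename σ (f : MvPowerSeries (Fin d) R) = f := f.2 σ
      change MvPowerSeries.rename σ (MvPowerSeries.map (iterateFrobenius R p N)
        (f : MvPowerSeries (Fin d) R)) = MvPowerSeries.map (iterateFrobenius R p N)
        (f : MvPowerSeries (Fin d) R)
      rw [MvPowerSeries.rename_map, h]

/-- The ring map of the `N`-fold relative Frobenius
`Div_d^+(𝔾) → Div_d^+((F_X^N)^* 𝔾)`: it is `R`-linear and sends `f(x_1, …, x_d)` to
`f(x_1 ^ (p ^ N), …, x_d ^ (p ^ N))`. -/
def relFrob (F : FormalGroup R) (p N d : ℕ) [ExpChar R p] :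
    (F.frobTwist p N).divRing d →ₐ[R] F.divRing d :=
  ((MvPowerSeries.expand (p ^ N) (pow_ne_zero N (expChar_ne_zero R p))).comp
    ((F.frobTwist p N).divRing d).val).codRestrict (F.divRing d) fun f σ => by
      have h : MvPowerSeries.rename σ (f : MvPowerSeries (Fin d) R) = f := f.2 σ
      have hX := MvPowerSeries.HasSubst.X_comp (R := R) (f := σ)
      have hp := pow_ne_zero N (expChar_ne_zero R p)
      change MvPowerSeries.rename σ (MvPowerSeries.expand (p ^ N) hp
        (f : MvPowerSeries (Fin d) R)) = MvPowerSeries.expand (p ^ N) hp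
        (f : MvPowerSeries (Fin d) R)
      conv_rhs => rw [← h]
      rw [MvPowerSeries.rename_eq_subst, MvPowerSeries.rename_eq_subst,
        MvPowerSeries.expand_subst _ hp hX, MvPowerSeries.expand,
        MvPowerSeries.substAlgHom_apply,
        MvPowerSeries.subst_comp_subst_apply (MvPowerSeries.HasSubst.X_pow hp) hX]
      congr 1
      funext i
      rw [MvPowerSeries.subst_pow hX, MvPowerSeries.subst_X hX]
      have hXp : MvPowerSeries.HasSubst fun s : Fin d =>
          (MvPowerSeries.X s : MvPowerSeries (Fin d) R) ^ p ^ N :=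
        MvPowerSeries.HasSubst.X_pow hp
      exact (MvPowerSeries.substAlgHom_X (R := R) hXp (σ i)).symm

/-- The defining property of the relative Frobenius: followed by the projection to `Div_d^+(𝔾)`
it is the `N`-fold absolute Frobenius of `Div_d^+(𝔾)`. -/
lemma relFrob_frobProj (F : FormalGroup R) (p N d : ℕ) [ExpChar R p] (f : F.divRing d) :
    F.relFrob p N d (F.frobProj p N d f) = f ^ p ^ N := by
  apply Subtype.ext
  change MvPowerSeries.expand (p ^ N) (pow_ne_zero N (expChar_ne_zero R p))
    (MvPowerSeries.map (iterateFrobenius R p N) (f : MvPowerSeries (Fin d) R)) = _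
  rw [← MvPowerSeries.map_expand, MvPowerSeries.map_iterateFrobenius_expand p (expChar_ne_zero R p)]
  rfl

/-- The ideal in the coordinate ring of `Div_d^+(𝔾)` of the fibre of the `N`-fold relative
Frobenius over the section `d[0]` of `Div_d^+((F_X^N)^* 𝔾)`. -/
def relFrobFibreIdeal (F : FormalGroup R) (p N d : ℕ) [ExpChar R p] : Ideal (F.divRing d) :=
  (RingHom.ker ((F.frobTwist p N).zeroDiv d)).map (F.relFrob p N d)

lemma chern_hasSubst (F : FormalGroup R) (d : ℕ) :
    MvPowerSeries.HasSubst fun j => (F.chern d j : MvPowerSeries (Fin d) R) := by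
  refine MvPowerSeries.hasSubst_of_constantCoeff_zero fun j => ?_
  change MvPowerSeries.constantCoeff ((divPoly R d).coeff (d - (j + 1))) = 0
  rw [← Polynomial.coeff_map, divPoly, Polynomial.map_prod]
  simp only [Polynomial.map_sub, Polynomial.map_X, Polynomial.map_C,
    MvPowerSeries.constantCoeff_X, map_zero, sub_zero, Finset.prod_const, Finset.card_univ,
    Fintype.card_fin, Polynomial.coeff_X_pow]
  rw [if_neg]
  have := j.2
  omega

/-- The ring map `R⟦c_1, …, c_d⟧ → 𝒪(Div_d^+(𝔾))` sending a power series to its value at the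
coordinate functions `c_k`. -/
def chernMap (F : FormalGroup R) (d : ℕ) : MvPowerSeries (Fin d) R →ₐ[R] F.divRing d :=
  (MvPowerSeries.substAlgHom (F.chern_hasSubst d)).codRestrict (F.divRing d) fun f σ => by
    have hX := MvPowerSeries.HasSubst.X_comp (R := R) (f := σ)
    change MvPowerSeries.rename σ (MvPowerSeries.substAlgHom (F.chern_hasSubst d) f) = _
    rw [MvPowerSeries.rename_eq_subst, MvPowerSeries.substAlgHom_apply,
      MvPowerSeries.subst_comp_subst_apply (F.chern_hasSubst d) hX]
    congr 1
    funext j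
    rw [← MvPowerSeries.rename_eq_subst]
    exact (F.chern d j).2 σ

end FormalGroup

end

/-!
The proof rests on one choice of coordinate. Over the residue field the formal group has finite
height, so `[p ^ v]_F(x)` is an invertible series in `x ^ N`, where `N = p ^ (n * v)`
(`FormalGroup.HasHeight.exists_mulSeries_pow_eq_expand`): a homomorphism of formal groups in
characteristic `p` whose derivative vanishes at the origin factors through the Frobenius
(`FormalGroup.exists_expand_eq_of_hom`). Lifting that invertible series to `R` gives
`[p ^ v]_F = h ∘ φ` with `h` invertible under composition and `φ` congruent to `x ^ N` modulo the maximal ideal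
(`FormalGroup.exists_mulSeries_eq_subst`). Since `h` is invertible, `φ` may replace `[p ^ v]_F`
both in the ideal of `𝔾(v)` and in the equations of `Z(v, d)`, and the latter become the vanishing
of the elementary symmetric functions of the `φ(x_i)` (`FormalGroup.zIdeal_eq_span`).

By the fundamental theorem on symmetric functions for power series
(`FormalGroup.chernMap_bijective`) these equations are power series `f_j` in `c_1, …, c_d`. In
characteristic `p` the Frobenius raises each `c_j` to its `N`-th power, so `f_j ≡ c_j ^ N` modulo
the maximal ideal. A division argument over the complete ring `R`
(`MvPowerSeries.exists_basis_quotient_span`) then shows that the monomials in the `c_j` with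
exponents less than `N` are a basis of `𝒪_Z`, which gives finiteness, flatness and the degree
`N ^ d`. Over a field the congruences are equalities, which is the description by the relative
Frobenius.

The same division argument in the variables `x_i` shows that for `ψ = φ` and `ψ = φ ^ d` the tensor
power of `R⟦x⟧ / (ψ)` is `R⟦x_1, …, x_d⟧ / (ψ(x_i))`, compatibly with the permutations of the bases
of monomials, so that every symmetric tensor comes from an invariant power series
(`exists_powerOfInclusion`). The inclusions thus compare the ideal `J` of `Z(v, d)` with the ideals
of invariants in `(φ(x_i))` and in `(φ(x_i) ^ d)`. The symmetric functions of the `φ(x_i)` lie in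
`(φ(x_i))`. Conversely `φ(x_i)` is a root of `∏ l, (t - φ(x_l))`, so `φ(x_i) ^ d` lies in the
extension of `J` to `R⟦x_1, …, x_d⟧`; as the invariants are a direct summand of `R⟦x_1, …, x_d⟧` as
a module over themselves (`FormalGroup.exists_retraction`, from the splitting algebra of a monic
polynomial), `J` contains every invariant in `(φ(x_i) ^ d)`. The same two facts show that the
kernels are nilpotent.
-/

noncomputable section

/-! ### Perturbation of the identity in adically complete function modules -/

section Adic

variable {R : Type*} [CommRing R] {ι : Type*}

/-- A linear endomorphism whose values have coordinates in `J` sends families with coordinates in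
a finitely generated ideal `K` to families with coordinates in `K * J`. Finite generation is what
makes this work for infinite families. -/
lemma LinearMap.apply_mem_mul_of_forall_mem {κ : Type*} (L : (ι → R) →ₗ[R] (κ → R)) {J K : Ideal R}
    (hL : ∀ v i, L v i ∈ J) (hK : K.FG) {w : ι → R} (hw : ∀ i, w i ∈ K) (i : κ) :
    L w i ∈ K * J := by
  obtain ⟨s, rfl⟩ := hK
  have key : ∀ j, ∃ c : s → R, ∑ l, c l * (l : R) = w j := fun j => by
    have := hw j
    rw [Submodule.mem_span_finset'] at this
    simpa using this
  choose c hc using key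
  have hwc : w = ∑ l : s, (l : R) • fun j => c j l := by
    funext j
    rw [← hc j]
    simp [mul_comm]
  rw [hwc, map_sum, Finset.sum_apply]
  refine Ideal.sum_mem _ fun l _ => ?_
  rw [map_smul, Pi.smul_apply, smul_eq_mul]
  exact Ideal.mul_mem_mul (Ideal.subset_span l.2) (hL _ _)

/-- An endomorphism of `ι → R` that is congruent to the identity modulo `I` is bijective if `R` is
`I`-adically complete: the inverse is a geometric series. -/
lemma LinearMap.bijective_of_forall_sub_mem [IsNoetherianRing R] (I : Ideal R)
    [IsAdicComplete I R] (T : (ι → R) →ₗ[R] (ι → R)) (hT : ∀ v i, v i - T v i ∈ I) :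
    Function.Bijective T := by
  set E : (ι → R) →ₗ[R] (ι → R) := LinearMap.id - T with hE
  have hEI : ∀ v i, E v i ∈ I := fun v i => hT v i
  have hpow : ∀ n v i, (E ^ n) v i ∈ I ^ n := by
    intro n
    induction n with
    | zero => intro v i; simp
    | succ n ih =>
      intro v i
      rw [pow_succ' E, pow_succ I, Module.End.mul_apply]
      exact E.apply_mem_mul_of_forall_mem hEI (IsNoetherian.noetherian _) (ih v) i
  have hzero : ∀ x : R, (∀ n, x ∈ I ^ n) → x = 0 := fun x hx =>
    IsHausdorff.haus (I := I) inferInstance x fun n => by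
      rw [SModEq.zero]; simpa using hx n
  have hTm : ∀ n (v : ι → R), (∀ i, v i ∈ I ^ n) → ∀ i, T v i ∈ I ^ n := by
    intro n v hv i
    have h := T.apply_mem_mul_of_forall_mem (J := ⊤) (fun _ _ => trivial)
      (IsNoetherian.noetherian (I ^ n)) hv i
    simpa using h
  constructor
  · rw [injective_iff_map_eq_zero]
    intro v hv
    have h1 : E v = v := by simp [hE, hv]
    have h2 : ∀ n, (E ^ n) v = v := by
      intro n
      induction n with
      | zero => simp
      | succ n ih => rw [pow_succ, Module.End.mul_apply, h1, ih]
    funext i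
    exact hzero _ fun n => by simpa [h2 n] using hpow n v i
  · intro w
    set u : ℕ → ι → R := fun n => ∑ k ∈ Finset.range n, (E ^ k) w with hu
    have hcau : ∀ i {m n}, m ≤ n → u m i ≡ u n i [SMOD (I ^ m • ⊤ : Submodule R R)] := by
      intro i m n hmn
      rw [SModEq.comm, SModEq.sub_mem]
      simp only [hu]
      rw [← Finset.sum_range_add_sum_Ico _ hmn]
      simp only [Pi.add_apply, add_sub_cancel_left, Finset.sum_apply, smul_eq_mul, Ideal.mul_top]
      refine Ideal.sum_mem _ fun k hk => ?_
      exact Ideal.pow_le_pow_right (Finset.mem_Ico.1 hk).1 (hpow k w i)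
    choose x hx using fun i => IsPrecomplete.prec (I := I) (M := R) inferInstance
      (f := fun n => u n i) (hcau i)
    refine ⟨x, ?_⟩
    funext i
    rw [← sub_eq_zero]
    refine hzero _ fun n => ?_
    have hTu : T (u n) = w - (E ^ n) w := by
      have hTE : T = LinearMap.id - E := by simp [hE]
      have : ∀ n, T (u n) = w - (E ^ n) w := by
        intro n
        induction n with
        | zero => simp [hu]
        | succ n ih =>
          have : u (n + 1) = u n + (E ^ n) w := by simp [hu, Finset.sum_range_succ]
          rw [this, map_add, ih, hTE, pow_succ']
          simp
      exact this n
    have h1 : T x i - w i = T (x - u n) i - (E ^ n) w i := by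
      rw [map_sub, hTu]
      simp only [Pi.sub_apply]
      ring
    rw [h1]
    refine Ideal.sub_mem _ (hTm n _ (fun j => ?_) i) (hpow n w i)
    have := hx j n
    rw [SModEq.comm, SModEq.sub_mem] at this
    simpa using this

end Adic

/-! ### Division by a system of power series congruent to powers of the variables -/

namespace MvPowerSeries

variable {R : Type*} [CommRing R] {σ : Type*}

/-- The exponent of the monomial `∏ i, x_i ^ a_i`. -/
def finExponent [Fintype σ] {M : ℕ} (a : σ → Fin M) : σ →₀ ℕ :=
  Finsupp.equivFunOnFinite.symm fun i => (a i : ℕ)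

@[simp]
lemma finExponent_apply [Fintype σ] {M : ℕ} (a : σ → Fin M) (i : σ) : finExponent a i = a i := rfl

variable [DecidableEq σ]

/-- Division with remainder of exponents by `M`. -/
def divModEquiv [Fintype σ] (M : ℕ) [NeZero M] :
    (σ →₀ ℕ) ≃ (σ → Fin M) × (σ →₀ ℕ) where
  toFun γ := (fun i => Fin.ofNat M (γ i), Finsupp.equivFunOnFinite.symm fun i => γ i / M)
  invFun x := finExponent x.1 + M • x.2
  left_inv γ := by
    ext i
    simp [Fin.ofNat, Nat.mod_add_div]
  right_inv x := by
    refine Prod.ext (funext fun i => Fin.ext ?_) (Finsupp.ext fun i => ?_)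
    · simp [Fin.ofNat, Nat.mod_eq_of_lt]
    · have hM : 0 < M := Nat.pos_of_ne_zero (NeZero.ne M)
      simp [Nat.add_mul_div_left _ _ hM, Nat.div_eq_of_lt]

/-- A power series in finitely many variables without constant term lies in the ideal generated
by the variables. -/
lemma exists_sum_X_mul_of_constantCoeff_eq_zero [Fintype σ] {f : MvPowerSeries σ R}
    (hf : constantCoeff f = 0) : ∃ h : σ → MvPowerSeries σ R, f = ∑ i, X i * h i := by
  -- each non-constant monomial is assigned to one of the variables that divide it
  have hex : ∀ γ : σ →₀ ℕ, ∃ i : Option σ, γ ≠ 0 → ∃ j, i = some j ∧ γ j ≠ 0 := by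
    intro γ
    by_cases hγ : γ = 0
    · exact ⟨none, fun h => (h hγ).elim⟩
    · obtain ⟨j, hj⟩ := Finsupp.ne_iff.1 hγ
      exact ⟨some j, fun _ => ⟨j, rfl, hj⟩⟩
  choose c hc using hex
  let h : σ → MvPowerSeries σ R := fun i δ =>
    if c (δ + Finsupp.single i 1) = some i then coeff (δ + Finsupp.single i 1) f else 0
  refine ⟨h, ?_⟩
  ext γ
  rw [map_sum]
  have hterm : ∀ i : σ, coeff γ (X i * h i) = if γ i ≠ 0 ∧ c γ = some i then coeff γ f else 0 := by
    intro i
    rw [X_def, coeff_monomial_mul, one_mul]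
    by_cases hi : γ i = 0
    · rw [if_neg (by simp [hi]), if_neg (by simp [hi])]
    · have hle : Finsupp.single i 1 ≤ γ := by simpa using Nat.one_le_iff_ne_zero.2 hi
      rw [if_pos hle]
      change (if _ then _ else _) = _
      rw [tsub_add_cancel_of_le hle]
      simp [hi]
  rw [Finset.sum_congr rfl fun i _ => hterm i]
  by_cases hγ : γ = 0
  · subst hγ
    simpa using hf
  · obtain ⟨j, hj, hj'⟩ := hc γ hγ
    rw [Finset.sum_eq_single j]
    · simp [hj, hj']
    · intro b _ hb
      rw [if_neg]
      rintro ⟨-, h⟩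
      rw [hj] at h
      exact hb (Option.some_injective _ h).symm
    · simp

/-- The map `(g_a)_a ↦ ∑ a, g_a(f) x^a`, with `a` running through the exponents that are less
than `M` in each variable. -/
def digitMap [Fintype σ] (M : ℕ) {f : σ → MvPowerSeries σ R} (hf : HasSubst f) :
    ((σ → Fin M) → MvPowerSeries σ R) →ₗ[R] MvPowerSeries σ R :=
  ∑ a : σ → Fin M, (LinearMap.mulRight R (monomial (finExponent a) (1 : R))).comp
    ((substAlgHom hf).toLinearMap.comp (LinearMap.proj a))

lemma digitMap_apply [Fintype σ] (M : ℕ) {f : σ → MvPowerSeries σ R} (hf : HasSubst f)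
    (g : (σ → Fin M) → MvPowerSeries σ R) :
    digitMap M hf g = ∑ a, (g a).subst f * monomial (finExponent a) (1 : R) := by
  simp [digitMap]

/-- If the series `f_i` are the powers `x_i ^ M`, then `digitMap` only reorders coefficients. -/
lemma coeff_digitMap_X_pow [Fintype σ] {M : ℕ} [NeZero M]
    (hf : HasSubst fun i : σ => (X i : MvPowerSeries σ R) ^ M)
    (g : (σ → Fin M) → MvPowerSeries σ R) (a : σ → Fin M) (q : σ →₀ ℕ) :
    coeff (finExponent a + M • q) (digitMap M hf g) = coeff q (g a) := by
  have hM : M ≠ 0 := NeZero.ne M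
  rw [digitMap_apply, map_sum, Finset.sum_eq_single a]
  · rw [coeff_mul_monomial, if_pos le_self_add, mul_one, add_tsub_cancel_left,
      ← coeff_expand_smul M hM (g a), expand, substAlgHom_apply]
  · intro b _ hb
    rw [coeff_mul_monomial]
    split_ifs with hle
    · rw [mul_one]
      obtain ⟨i, hi⟩ := Function.ne_iff.1 hb
      have h1 := hle i
      simp only [finExponent_apply, Finsupp.coe_add, Finsupp.coe_smul, Pi.add_apply,
        Pi.smul_apply, smul_eq_mul] at h1
      have hnd : ¬ M ∣ (finExponent a + M • q - finExponent b) i := by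
        simp only [finExponent_apply, Finsupp.coe_tsub, Finsupp.coe_add, Finsupp.coe_smul,
          Pi.sub_apply, Pi.add_apply, Pi.smul_apply, smul_eq_mul]
        intro hdvd
        have h2 : (b i : ℕ) ≡ a i + M * q i [MOD M] := (Nat.modEq_iff_dvd' h1).2 hdvd
        have h3 : (b i : ℕ) ≡ a i [MOD M] := by simpa [Nat.ModEq] using h2
        exact hi (Fin.ext (Nat.ModEq.eq_of_lt_of_lt h3 (b i).2 (a i).2))
      have := coeff_expand_of_not_dvd (R := R) M hM (g b) hnd
      rwa [expand, substAlgHom_apply] at this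
    · rfl
  · simp

/-- Multivariate Weierstrass division: if `R` is `I`-adically complete and `f_i ≡ x_i ^ M` modulo
`I`, then `R⟦x⟧` is free over `R⟦y⟧`, embedded by `y_i ↦ f_i`, on the monomials of degree less
than `M` in each variable. -/
theorem bijective_digitMap [Fintype σ] [IsNoetherianRing R] (I : Ideal R) [IsAdicComplete I R]
    {M : ℕ} [NeZero M] {f : σ → MvPowerSeries σ R} (hf : HasSubst f)
    (hfX : ∀ i, map (Ideal.Quotient.mk I) (f i) = X i ^ M) :
    Function.Bijective (digitMap M hf) := by
  have hM : M ≠ 0 := NeZero.ne M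
  have hX : HasSubst fun i : σ => (X i : MvPowerSeries σ R) ^ M := HasSubst.X_pow hM
  have hX' : HasSubst fun i : σ => (X i : MvPowerSeries σ (R ⧸ I)) ^ M := HasSubst.X_pow hM
  -- composed with the reordering of coefficients, `digitMap` is the identity modulo `I`
  let e : ((σ →₀ ℕ) → R) ≃ₗ[R] ((σ → Fin M) → MvPowerSeries σ R) :=
    { toFun := fun v a q => v (finExponent a + M • q)
      invFun := fun g γ => coeff (divModEquiv M γ).2 (g (divModEquiv M γ).1)
      map_add' := fun _ _ => rfl
      map_smul' := fun _ _ => rfl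
      left_inv := fun v => funext fun γ => congrArg v ((divModEquiv M).left_inv γ)
      right_inv := fun g => funext fun a => funext fun q => by
        have h := (divModEquiv M).right_inv (a, q)
        change coeff (divModEquiv M ((divModEquiv M).symm (a, q))).2
          (g (divModEquiv M ((divModEquiv M).symm (a, q))).1) = _
        rw [Equiv.apply_symm_apply]
        rfl }
  have hmap : ∀ g, map (Ideal.Quotient.mk I) (digitMap M hf g) =
      map (Ideal.Quotient.mk I) (digitMap M hX g) := by
    intro g
    simp only [digitMap_apply, map_sum, map_mul, map_subst hf, map_subst hX, hfX, map_pow, map_X]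
  have hbij : Function.Bijective ((digitMap M hf).comp e.toLinearMap) := by
    refine LinearMap.bijective_of_forall_sub_mem I (ι := σ →₀ ℕ) _ fun v γ => ?_
    rw [← Ideal.Quotient.eq]
    have h1 := congrArg (coeff γ) (hmap (e v))
    rw [coeff_map, coeff_map] at h1
    refine Eq.trans ?_ h1.symm
    congr 1
    obtain ⟨⟨a, q⟩, rfl⟩ := (divModEquiv M).symm.surjective γ
    exact (coeff_digitMap_X_pow hX (e v) a q).symm
  rw [LinearMap.coe_comp] at hbij
  exact (Function.Bijective.of_comp_iff _ e.bijective).1 hbij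

/-- The value of a power series at `f` is congruent to its constant term modulo the ideal
generated by the `f_i`. -/
lemma subst_sub_C_mem_span [Fintype σ] {τ : Type*} {f : σ → MvPowerSeries τ R} (hf : HasSubst f)
    (g : MvPowerSeries σ R) : g.subst f - C (constantCoeff g) ∈ Ideal.span (Set.range f) := by
  obtain ⟨h, hh⟩ := exists_sum_X_mul_of_constantCoeff_eq_zero
    (f := g - C (constantCoeff g)) (by simp)
  have h1 : g.subst f - C (constantCoeff g) = ∑ i, f i * (h i).subst f := by
    have h2 := congrArg (substAlgHom hf) hh
    simp only [map_sub, map_sum, map_mul, substAlgHom_X] at h2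
    rw [c_eq_algebraMap, AlgHom.commutes, substAlgHom_apply] at h2
    rw [c_eq_algebraMap, h2]
    simp [substAlgHom_apply]
  rw [h1]
  exact Ideal.sum_mem _ fun i _ => Ideal.mul_mem_right _ _ (Ideal.subset_span ⟨i, rfl⟩)

/-- If `R` is `I`-adically complete and `f_i ≡ x_i ^ M` modulo `I`, then the monomials of degree
less than `M` in each variable form a basis of `R⟦x⟧ / (f_i)`. -/
theorem exists_basis_quotient_span [Fintype σ] [IsNoetherianRing R] (I : Ideal R)
    [IsAdicComplete I R] {M : ℕ} [NeZero M] {f : σ → MvPowerSeries σ R}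
    (hf0 : ∀ i, constantCoeff (f i) = 0)
    (hfX : ∀ i, map (Ideal.Quotient.mk I) (f i) = X i ^ M) :
    ∃ b : Module.Basis (σ → Fin M) R (MvPowerSeries σ R ⧸ Ideal.span (Set.range f)),
      ∀ a, b a = Ideal.Quotient.mk _ (monomial (finExponent a) (1 : R)) := by
  have hf : HasSubst f := hasSubst_of_constantCoeff_zero hf0
  have hT := bijective_digitMap I hf hfX
  set J := Ideal.span (Set.range f)
  have hC : ∀ (r : R) (u : MvPowerSeries σ R), r • Ideal.Quotient.mk J u =
      Ideal.Quotient.mk J (C r * u) := fun r u => by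
    rw [← smul_eq_C_mul]; rfl
  have hli : LinearIndependent R fun a : σ → Fin M =>
      Ideal.Quotient.mk J (monomial (finExponent a) (1 : R)) := by
    rw [Fintype.linearIndependent_iff]
    intro r hr a
    simp only [hC] at hr
    rw [← map_sum, Ideal.Quotient.eq_zero_iff_mem, Ideal.mem_span_range_iff_exists_fun] at hr
    obtain ⟨c, hc⟩ := hr
    choose g hg using fun i => hT.2 (c i)
    have h1 : digitMap M hf (fun a => C (r a)) =
        digitMap M hf (fun a => ∑ i, X i * g i a) := by
      have h2 : digitMap M hf (fun a => C (r a)) =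
          ∑ a, C (r a) * monomial (finExponent a) (1 : R) := by
        rw [digitMap_apply]
        refine Finset.sum_congr rfl fun a _ => ?_
        rw [← substAlgHom_apply hf, c_eq_algebraMap, AlgHom.commutes]
      rw [h2, ← hc, digitMap_apply]
      simp_rw [← substAlgHom_apply hf, map_sum, map_mul, substAlgHom_X, Finset.sum_mul]
      rw [Finset.sum_comm]
      refine Finset.sum_congr rfl fun i _ => ?_
      rw [← hg i, digitMap_apply, Finset.sum_mul]
      refine Finset.sum_congr rfl fun a _ => ?_
      rw [substAlgHom_apply]
      ring
    have h3 := congrArg constantCoeff (congrFun (hT.1 h1) a)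
    simpa using h3
  have hsp : ⊤ ≤ Submodule.span R (Set.range fun a : σ → Fin M =>
      Ideal.Quotient.mk J (monomial (finExponent a) (1 : R))) := by
    rintro x -
    obtain ⟨h, rfl⟩ := Ideal.Quotient.mk_surjective x
    obtain ⟨g, rfl⟩ := hT.2 h
    rw [digitMap_apply, map_sum]
    refine Submodule.sum_mem _ fun a _ => ?_
    have h1 : Ideal.Quotient.mk J ((g a).subst f) =
        Ideal.Quotient.mk J (C (constantCoeff (g a))) :=
      Ideal.Quotient.eq.2 (subst_sub_C_mem_span hf (g a))
    rw [map_mul, h1, ← map_mul, ← hC]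
    exact Submodule.smul_mem _ _ (Submodule.subset_span ⟨a, rfl⟩)
  exact ⟨Module.Basis.mk hli hsp, fun a => by simp⟩

end MvPowerSeries

/-! ### Graded substitutions into power series -/

namespace MvPowerSeries

variable {R : Type*} [CommRing R] {σ τ : Type*}

/-- The part of weight `n` of a power series in finitely many variables, as a polynomial, for
positive weights of the variables. -/
def weightedPart [Finite σ] (w : σ → ℕ) (hw : ∀ i, w i ≠ 0) (n : ℕ) (f : MvPowerSeries σ R) :
    MvPolynomial σ R :=
  ∑ β ∈ (Finsupp.finite_of_nat_weight_eq w hw n).toFinset, MvPolynomial.monomial β (coeff β f)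

lemma coeff_weightedPart [Finite σ] (w : σ → ℕ) (hw : ∀ i, w i ≠ 0) (n : ℕ)
    (f : MvPowerSeries σ R) (β : σ →₀ ℕ) :
    (weightedPart w hw n f).coeff β = if Finsupp.weight w β = n then coeff β f else 0 := by
  classical
  simp [weightedPart, MvPolynomial.coeff_sum, MvPolynomial.coeff_monomial]

/-- A product of powers of homogeneous polynomials is homogeneous. -/
lemma _root_.MvPolynomial.isHomogeneous_finsuppProd {w : σ → ℕ}
    {c : σ → MvPolynomial τ R} (hc : ∀ i, (c i).IsHomogeneous (w i)) (β : σ →₀ ℕ) :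
    (β.prod fun i e => c i ^ e).IsHomogeneous (Finsupp.weight w β) := by
  rw [Finsupp.weight_apply, Finsupp.sum, Finsupp.prod]
  refine MvPolynomial.IsHomogeneous.prod _ _ _ fun i _ => ?_
  simpa [mul_comm] using (hc i).pow (β i)

/-- If the `c_i` are homogeneous of degrees `w_i`, the part of degree `n` of `f(c)` is the
value at `c` of the part of weight `n` of `f`. -/
lemma coeff_subst_of_isHomogeneous [Finite σ] {w : σ → ℕ} (hw : ∀ i, w i ≠ 0)
    {c : σ → MvPolynomial τ R} (hcs : HasSubst fun i => (c i : MvPowerSeries τ R))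
    (hc : ∀ i, (c i).IsHomogeneous (w i)) (f : MvPowerSeries σ R) (γ : τ →₀ ℕ) :
    coeff γ (f.subst fun i => (c i : MvPowerSeries τ R)) =
      (MvPolynomial.aeval c (weightedPart w hw γ.degree f)).coeff γ := by
  have hcoe : ∀ P : MvPolynomial σ R, ((MvPolynomial.aeval c P : MvPolynomial τ R) :
      MvPowerSeries τ R) = (P : MvPowerSeries σ R).subst fun i => (c i : MvPowerSeries τ R) := by
    intro P
    rw [subst_coe]
    change MvPolynomial.coeToMvPowerSeries.algHom R (MvPolynomial.aeval c P) = _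
    rw [← AlgHom.comp_apply, MvPolynomial.comp_aeval]
    simp
  rw [← MvPolynomial.coeff_coe, hcoe, coeff_subst hcs, coeff_subst hcs]
  refine finsum_congr fun β => ?_
  rw [MvPolynomial.coeff_coe, coeff_weightedPart]
  split_ifs with h
  · rfl
  · have h0 : coeff γ (β.prod fun i e => (c i : MvPowerSeries τ R) ^ e) = 0 := by
      have h1 : (β.prod fun i e => (c i : MvPowerSeries τ R) ^ e) =
          ((β.prod fun i e => c i ^ e : MvPolynomial τ R) : MvPowerSeries τ R) := by
        simp only [Finsupp.prod]
        change _ = MvPolynomial.coeToMvPowerSeries.ringHom _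
        simp
      rw [h1, MvPolynomial.coeff_coe]
      exact (MvPolynomial.isHomogeneous_finsuppProd hc β).coeff_eq_zero (Ne.symm h)
    rw [h0, smul_zero, smul_zero]

/-- The value at `c` of a polynomial of weight `n` is homogeneous of degree `n`. -/
lemma isHomogeneous_aeval_weightedPart [Finite σ] {w : σ → ℕ} (hw : ∀ i, w i ≠ 0)
    {c : σ → MvPolynomial τ R} (hc : ∀ i, (c i).IsHomogeneous (w i)) (n : ℕ)
    (f : MvPowerSeries σ R) :
    (MvPolynomial.aeval c (weightedPart w hw n f)).IsHomogeneous n := by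
  rw [weightedPart, map_sum]
  refine MvPolynomial.IsHomogeneous.sum _ _ _ fun β hβ => ?_
  rw [MvPolynomial.aeval_monomial]
  have h := MvPolynomial.isHomogeneous_finsuppProd hc β
  rw [(Set.Finite.mem_toFinset _).1 hβ] at h
  exact h.C_mul _

/-- Algebraically independent homogeneous polynomials of positive degrees are independent in the
sense of power series. -/
lemma subst_injective_of_isHomogeneous [Finite σ] {w : σ → ℕ} (hw : ∀ i, w i ≠ 0)
    {c : σ → MvPolynomial τ R} (hcs : HasSubst fun i => (c i : MvPowerSeries τ R))
    (hc : ∀ i, (c i).IsHomogeneous (w i))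
    (hinj : Function.Injective (MvPolynomial.aeval c : MvPolynomial σ R →ₐ[R] MvPolynomial τ R)) :
    Function.Injective (substAlgHom hcs : MvPowerSeries σ R →ₐ[R] MvPowerSeries τ R) := by
  rw [injective_iff_map_eq_zero]
  intro f hf
  rw [substAlgHom_apply] at hf
  ext β
  have h0 : MvPolynomial.aeval c (weightedPart w hw (Finsupp.weight w β) f) = 0 := by
    ext γ
    by_cases hγ : γ.degree = Finsupp.weight w β
    · rw [← hγ, ← coeff_subst_of_isHomogeneous hw hcs hc, hf]
      simp
    · rw [(isHomogeneous_aeval_weightedPart hw hc _ f).coeff_eq_zero hγ]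
      simp
  have h1 := congrArg (MvPolynomial.coeff β) (hinj (h0.trans (map_zero _).symm))
  rw [coeff_weightedPart, if_pos rfl] at h1
  simpa using h1

/-- The homogeneous parts of a power series. -/
abbrev homogeneousPart [Finite σ] (n : ℕ) (f : MvPowerSeries σ R) : MvPolynomial σ R :=
  weightedPart (fun _ => 1) (fun _ => one_ne_zero) n f

lemma coeff_homogeneousPart [Finite σ] (n : ℕ) (f : MvPowerSeries σ R) (β : σ →₀ ℕ) :
    (homogeneousPart n f).coeff β = if β.degree = n then coeff β f else 0 := by
  rw [homogeneousPart, coeff_weightedPart, Finsupp.degree_eq_weight_one]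

/-- If all homogeneous parts of a power series are polynomials in the `c_i`, then it is a power
series in the `c_i`. -/
lemma exists_subst_eq_of_isHomogeneous [Finite σ] [Finite τ] {w : σ → ℕ} (hw : ∀ i, w i ≠ 0)
    {c : σ → MvPolynomial τ R} (hcs : HasSubst fun i => (c i : MvPowerSeries τ R))
    (hc : ∀ i, (c i).IsHomogeneous (w i)) {s : MvPowerSeries τ R}
    (hs : ∀ n, ∃ P : MvPolynomial σ R, MvPolynomial.aeval c P = homogeneousPart n s) :
    ∃ f : MvPowerSeries σ R, f.subst (fun i => (c i : MvPowerSeries τ R)) = s := by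
  choose P hP using hs
  let f : MvPowerSeries σ R := fun β => (P (Finsupp.weight w β)).coeff β
  refine ⟨f, ?_⟩
  ext γ
  have h1 : weightedPart w hw γ.degree f = weightedPart w hw γ.degree (P γ.degree) := by
    ext β
    rw [coeff_weightedPart, coeff_weightedPart]
    split_ifs with h
    · rw [MvPolynomial.coeff_coe, ← h]
      rfl
    · rfl
  have h2 : (P γ.degree : MvPowerSeries σ R).subst (fun i => (c i : MvPowerSeries τ R)) =
      ((homogeneousPart γ.degree s : MvPolynomial τ R) : MvPowerSeries τ R) := by
    rw [subst_coe, ← hP]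
    change _ = MvPolynomial.coeToMvPowerSeries.algHom R (MvPolynomial.aeval c (P γ.degree))
    rw [← AlgHom.comp_apply, MvPolynomial.comp_aeval]
    simp
  rw [coeff_subst_of_isHomogeneous hw hcs hc, h1, ← coeff_subst_of_isHomogeneous hw hcs hc, h2,
    MvPolynomial.coeff_coe, coeff_homogeneousPart, if_pos rfl]

end MvPowerSeries

/-! ### The ring of symmetric power series -/

namespace FormalGroup

open MvPowerSeries

variable {R : Type*} [CommRing R]

/-- The coordinate function `c_{j + 1}` on divisors, as a polynomial in the `x_i`. -/
def chernPoly (R : Type*) [CommRing R] (d : ℕ) (j : Fin d) : MvPolynomial (Fin d) R :=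
  (-1) ^ (j + 1 : ℕ) * MvPolynomial.esymm (Fin d) R (j + 1)

/-- Vieta's formula for the product of the `t - b_i`. -/
lemma coeff_prod_X_sub_C {A : Type*} [CommRing A] [Algebra R A] {d : ℕ} (b : Fin d → A)
    (j : Fin d) : (∏ i, (Polynomial.X - Polynomial.C (b i))).coeff (d - (j + 1)) =
      MvPolynomial.aeval b (chernPoly R d j) := by
  have h := Multiset.prod_X_sub_C_coeff (Finset.univ.val.map b) (k := d - (j + 1)) (by simp)
  have hj : d - (d - (j + 1 : ℕ)) = j + 1 := by have := j.2; omega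
  rw [Multiset.map_map] at h
  simp only [Multiset.card_map, Finset.card_val, Finset.card_univ, Fintype.card_fin, hj] at h
  rw [chernPoly, map_mul, MvPolynomial.aeval_esymm_eq_multiset_esymm, map_pow, map_neg, map_one,
    ← h]
  rfl

lemma chern_coe (F : FormalGroup R) (d : ℕ) (j : Fin d) :
    (F.chern d j : MvPowerSeries (Fin d) R) = (chernPoly R d j : MvPowerSeries (Fin d) R) := by
  change (divPoly R d).coeff (d - (j + 1)) = _
  rw [divPoly, coeff_prod_X_sub_C (R := R)]
  change _ = MvPolynomial.coeToMvPowerSeries.algHom R (chernPoly R d j)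
  conv_rhs => rw [← MvPolynomial.aeval_X_left_apply (chernPoly R d j)]
  rw [← AlgHom.comp_apply, MvPolynomial.comp_aeval]
  simp

lemma chernPoly_isHomogeneous (d : ℕ) (j : Fin d) :
    (chernPoly R d j).IsHomogeneous (j + 1) := by
  have h : (MvPolynomial.esymm (Fin d) R (j + 1)).IsHomogeneous (j + 1) := by
    refine MvPolynomial.IsHomogeneous.sum _ _ _ fun t ht => ?_
    have := MvPolynomial.IsHomogeneous.prod t (fun i => (MvPolynomial.X i : MvPolynomial (Fin d) R))
      (fun _ => 1) fun i _ => MvPolynomial.isHomogeneous_X _ _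
    simpa [(Finset.mem_powersetCard.1 ht).2] using this
  have h2 := h.C_mul ((-1 : R) ^ (j + 1 : ℕ))
  simpa [chernPoly] using h2

/-- The `chernPoly` differ from the elementary symmetric polynomials by signs, so that evaluation at
them is evaluation at the latter after a change of signs of the variables. -/
lemma aeval_chernPoly (d : ℕ) (q : MvPolynomial (Fin d) R) :
    MvPolynomial.aeval (chernPoly R d) q = MvPolynomial.esymmAlgEquiv (Fin d) R (Fintype.card_fin d)
      (MvPolynomial.aeval (fun j : Fin d => (-1 : MvPolynomial (Fin d) R) ^ (j + 1 : ℕ) *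
        MvPolynomial.X j) q) := by
  rw [MvPolynomial.esymmAlgEquiv_apply, MvPolynomial.esymmAlgHom_apply, ← AlgHom.comp_apply,
    MvPolynomial.comp_aeval]
  congr 2
  funext j
  simp [chernPoly]

lemma aeval_sign_involutive (d : ℕ) : Function.Involutive
    (MvPolynomial.aeval (R := R) fun j : Fin d => (-1 : MvPolynomial (Fin d) R) ^ (j + 1 : ℕ) *
      MvPolynomial.X j) := by
  intro q
  rw [← AlgHom.comp_apply, MvPolynomial.comp_aeval]
  conv_rhs => rw [← MvPolynomial.aeval_X_left_apply q]
  congr 2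
  funext j
  simp [← mul_assoc, ← mul_pow]

lemma aeval_chernPoly_injective (d : ℕ) : Function.Injective
    (MvPolynomial.aeval (chernPoly R d) : MvPolynomial (Fin d) R →ₐ[R] MvPolynomial (Fin d) R) := by
  intro p q h
  rw [aeval_chernPoly, aeval_chernPoly] at h
  exact (aeval_sign_involutive d).injective ((AlgEquiv.injective _) (Subtype.ext h))

lemma exists_aeval_chernPoly_eq {d : ℕ} {p : MvPolynomial (Fin d) R} (hp : p.IsSymmetric) :
    ∃ q : MvPolynomial (Fin d) R, MvPolynomial.aeval (chernPoly R d) q = p := by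
  obtain ⟨q, hq⟩ := (MvPolynomial.esymmAlgEquiv (Fin d) R (Fintype.card_fin d)).surjective ⟨p, hp⟩
  refine ⟨MvPolynomial.aeval (fun j : Fin d => (-1 : MvPolynomial (Fin d) R) ^ (j + 1 : ℕ) *
    MvPolynomial.X j) q, ?_⟩
  rw [aeval_chernPoly, (aeval_sign_involutive d) q, hq]

lemma rename_homogeneousPart {d : ℕ} (σ : Equiv.Perm (Fin d)) (n : ℕ)
    (f : MvPowerSeries (Fin d) R) :
    MvPolynomial.rename σ (homogeneousPart n f) = homogeneousPart n (MvPowerSeries.rename σ f) := by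
  ext γ
  obtain ⟨β, rfl⟩ : ∃ β : Fin d →₀ ℕ, β.embDomain σ.toEmbedding = γ :=
    ⟨γ.embDomain σ.symm.toEmbedding, by ext i; simp [Finsupp.embDomain_eq_mapDomain,
      ← Finsupp.mapDomain_comp]⟩
  have h1 : β.embDomain σ.toEmbedding = β.mapDomain σ := Finsupp.embDomain_eq_mapDomain _ _
  have h2 : coeff (β.embDomain σ.toEmbedding) (MvPowerSeries.rename σ f) = coeff β f :=
    coeff_embDomain_rename σ.toEmbedding f β
  rw [coeff_homogeneousPart, h2, h1, MvPolynomial.coeff_rename_mapDomain _ σ.injective,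
    coeff_homogeneousPart, Finsupp.degree_mapDomain]

lemma homogeneousPart_isSymmetric (F : FormalGroup R) {d : ℕ} (n : ℕ) (f : F.divRing d) :
    (homogeneousPart n (f : MvPowerSeries (Fin d) R)).IsSymmetric := fun σ => by
  rw [rename_homogeneousPart]
  congr 1
  exact f.2 σ

/-- The fundamental theorem on symmetric functions, for power series: the coordinate ring of
`Div_d^+(𝔾)` is `R⟦c_1, …, c_d⟧`. -/
theorem chernMap_bijective (F : FormalGroup R) (d : ℕ) : Function.Bijective (F.chernMap d) := by
  have hw : ∀ j : Fin d, (j + 1 : ℕ) ≠ 0 := fun j => Nat.succ_ne_zero _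
  have hcs : HasSubst fun j => (chernPoly R d j : MvPowerSeries (Fin d) R) := by
    have := F.chern_hasSubst d
    simp only [chern_coe] at this
    exact this
  have hval : ∀ f, (F.chernMap d f : MvPowerSeries (Fin d) R) =
      f.subst fun j => (chernPoly R d j : MvPowerSeries (Fin d) R) := by
    intro f
    change substAlgHom (F.chern_hasSubst d) f = _
    rw [substAlgHom_apply]
    simp only [chern_coe]
  constructor
  · intro f g h
    refine subst_injective_of_isHomogeneous hw hcs (fun j => chernPoly_isHomogeneous d j)
      (aeval_chernPoly_injective d) ?_
    rw [substAlgHom_apply, substAlgHom_apply, ← hval, ← hval, h]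
  · intro s
    obtain ⟨f, hf⟩ := exists_subst_eq_of_isHomogeneous hw hcs (fun j => chernPoly_isHomogeneous d j)
      (s := (s : MvPowerSeries (Fin d) R))
      fun n => exists_aeval_chernPoly_eq (F.homogeneousPart_isSymmetric n s)
    exact ⟨f, Subtype.ext ((hval f).trans hf)⟩

end FormalGroup

/-! ### A retraction onto the symmetric power series -/

section Retraction

/-- Every monic polynomial splits into linear factors over some extension from which there is a
linear retraction. The extension is obtained by adjoining one root after the other; each step is
free on the powers of the root, the first of which is `1`. -/
lemma Polynomial.exists_splitting_retraction.{u} (d : ℕ) :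
    ∀ (A : Type u) [CommRing A] (f : Polynomial A), f.Monic → f.natDegree = d →
      ∃ (E : Type u) (_ : CommRing E) (_ : Algebra A E) (b : Fin d → E) (ρ : E →ₗ[A] A),
        f.map (algebraMap A E) = ∏ i, (Polynomial.X - Polynomial.C (b i)) ∧ ρ 1 = 1 := by
  induction d with
  | zero =>
    intro A _ f hf hd
    refine ⟨A, inferInstance, inferInstance, Fin.elim0, LinearMap.id, ?_, rfl⟩
    rw [(hf.natDegree_eq_zero).1 hd]
    simp
  | succ d ih =>
    intro A _ f hf hd
    rcases subsingleton_or_nontrivial A with hA | hA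
    · refine ⟨A, inferInstance, inferInstance, fun _ => 0, LinearMap.id, ?_, rfl⟩
      exact Subsingleton.elim _ _
    let A₁ := AdjoinRoot f
    have hfm : (f.map (AdjoinRoot.of f)).Monic := hf.map _
    obtain ⟨g, hg⟩ : (Polynomial.X - Polynomial.C (AdjoinRoot.root f)) ∣ f.map (AdjoinRoot.of f) :=
      Polynomial.dvd_iff_isRoot.2 (AdjoinRoot.isRoot_root f)
    have hgm : g.Monic := (Polynomial.monic_X_sub_C _).of_mul_monic_left (hg ▸ hfm)
    have hone : AdjoinRoot.modByMonicHom hf 1 = 1 := by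
      rw [← map_one (AdjoinRoot.mk f), AdjoinRoot.modByMonicHom_mk,
        (Polynomial.modByMonic_eq_self_iff hf).2]
      rw [Polynomial.degree_one, Polynomial.degree_eq_natDegree hf.ne_zero, hd]
      exact_mod_cast Nat.succ_pos d
    have : Nontrivial A₁ := ⟨1, 0, fun h => by
      rw [show (1 : AdjoinRoot f) = 0 from h, map_zero] at hone
      exact zero_ne_one hone⟩
    have hgd : g.natDegree = d := by
      have h1 := congrArg Polynomial.natDegree hg
      rw [hf.natDegree_map, hd, (Polynomial.monic_X_sub_C _).natDegree_mul hgm,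
        Polynomial.natDegree_X_sub_C] at h1
      omega
    obtain ⟨E, _, _, b, ρ, hfac, hρ⟩ := ih A₁ g hgm hgd
    let : Algebra A E := ((algebraMap A₁ E).comp (AdjoinRoot.of f)).toAlgebra
    have : IsScalarTower A A₁ E := IsScalarTower.of_algebraMap_eq fun _ => rfl
    refine ⟨E, inferInstance, inferInstance, Fin.cons (algebraMap A₁ E (AdjoinRoot.root f)) b,
      (Polynomial.lcoeff A 0).comp ((AdjoinRoot.modByMonicHom hf).comp (ρ.restrictScalars A)),
      ?_, ?_⟩
    · rw [Fin.prod_univ_succ]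
      simp only [Fin.cons_zero, Fin.cons_succ]
      rw [← hfac, IsScalarTower.algebraMap_eq A A₁ E, ← Polynomial.map_map]
      change Polynomial.map _ (f.map (AdjoinRoot.of f)) = _
      rw [hg, Polynomial.map_mul]
      simp
    · simp only [LinearMap.comp_apply, LinearMap.restrictScalars_apply, hρ]
      rw [hone]
      simp

/-- An ideal is recovered from its extension along a ring extension with a linear retraction. -/
lemma Ideal.mem_of_algebraMap_mem_map {S B : Type*} [CommRing S] [CommRing B] [Algebra S B]
    (ρ : B →ₗ[S] S) (hρ : ρ 1 = 1) {I : Ideal S} {s : S}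
    (hs : algebraMap S B s ∈ I.map (algebraMap S B)) : s ∈ I := by
  have key : ∀ y ∈ I.map (algebraMap S B), ∀ b : B, ρ (b * y) ∈ I := by
    intro y hy
    refine Submodule.span_induction (p := fun y _ => ∀ b : B, ρ (b * y) ∈ I) ?_ ?_ ?_ ?_ hy
    · rintro _ ⟨i, hi, rfl⟩ b
      rw [mul_comm, ← Algebra.smul_def, map_smul]
      exact Ideal.mul_mem_right _ _ hi
    · intro b
      simp
    · intro x y _ _ hx hy b
      rw [mul_add, map_add]
      exact I.add_mem (hx b) (hy b)
    · intro a x _ hx b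
      rw [smul_eq_mul, ← mul_assoc]
      exact hx _
  have h := key _ hs 1
  rwa [one_mul, Algebra.algebraMap_eq_smul_one, map_smul, hρ, smul_eq_mul, mul_one] at h

end Retraction

namespace FormalGroup

open MvPowerSeries

variable {R : Type*} [CommRing R]

/-- The polynomial ring retracts linearly onto the ring `A` of symmetric polynomials: it maps over
`A` to every extension of `A` in which `∏ i, (t - x_i)` splits, and there is such an extension with
a retraction to `A`. -/
lemma exists_polynomial_retraction (R : Type*) [CommRing R] (d : ℕ) :
    ∃ ρ : MvPolynomial (Fin d) R →ₗ[MvPolynomial.symmetricSubalgebra (Fin d) R]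
      MvPolynomial.symmetricSubalgebra (Fin d) R, ρ 1 = 1 := by
  rcases subsingleton_or_nontrivial R with hR | hR
  · exact ⟨0, Subsingleton.elim _ _⟩
  set A := MvPolynomial.symmetricSubalgebra (Fin d) R
  let P : Polynomial (MvPolynomial (Fin d) R) :=
    ∏ i, (Polynomial.X - Polynomial.C (MvPolynomial.X i))
  have hPm : P.Monic := Polynomial.monic_prod_of_monic _ _ fun i _ => Polynomial.monic_X_sub_C _
  have hlift : ∀ k, P.coeff k ∈ Set.range (algebraMap A (MvPolynomial (Fin d) R)) := by
    intro k
    refine ⟨⟨P.coeff k, fun σ => ?_⟩, rfl⟩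
    have h : P.map (MvPolynomial.rename σ).toRingHom = P := by
      simp only [P]
      rw [Polynomial.map_prod, ← Equiv.prod_comp σ
        fun i => Polynomial.X - Polynomial.C (MvPolynomial.X i : MvPolynomial (Fin d) R)]
      refine Finset.prod_congr rfl fun i _ => ?_
      simp
    change (MvPolynomial.rename σ).toRingHom _ = _
    rw [← Polynomial.coeff_map, h]
  obtain ⟨q, hqP, hqd, hqm⟩ := Polynomial.lifts_and_natDegree_eq_and_monic
    (f := algebraMap A (MvPolynomial (Fin d) R)) ((Polynomial.lifts_iff_coeff_lifts _).2 hlift) hPm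
  have hPd : P.natDegree = d := by
    simp only [P]
    rw [Polynomial.natDegree_prod_of_monic _ _ fun i _ => Polynomial.monic_X_sub_C _]
    simp
  obtain ⟨E, _, _, b, ρ, hfac, hρ⟩ :=
    Polynomial.exists_splitting_retraction d A q hqm (hqd.trans hPd)
  let e : MvPolynomial (Fin d) R →+* E :=
    MvPolynomial.eval₂Hom ((algebraMap A E).comp (algebraMap R A)) b
  have hqc : ∀ k, ((q.coeff k : A) : MvPolynomial (Fin d) R) = P.coeff k := fun k => by
    rw [← hqP, Polynomial.coeff_map]
    rfl
  have hPe : P.map e = q.map (algebraMap A E) := by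
    rw [hfac]
    simp only [P]
    rw [Polynomial.map_prod]
    simp [e]
  let c : MvPolynomial (Fin d) R →ₐ[R] A :=
    MvPolynomial.aeval fun j : Fin d => q.coeff (d - (j + 1))
  -- `e` is linear over the symmetric polynomials, as these are polynomials in the coefficients
  -- of `∏ i, (t - x_i)`
  have hcval : ∀ j : Fin d, ((q.coeff (d - (j + 1)) : A) : MvPolynomial (Fin d) R) =
      chernPoly R d j := by
    intro j
    rw [hqc, coeff_prod_X_sub_C (R := R), MvPolynomial.aeval_X_left_apply]
  have hc : Function.Surjective c := by
    intro a
    obtain ⟨u, hu⟩ := exists_aeval_chernPoly_eq a.2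
    refine ⟨u, Subtype.ext ?_⟩
    rw [← hu]
    change A.val (c u) = _
    rw [← AlgHom.comp_apply, MvPolynomial.comp_aeval]
    congr 2
    funext j
    exact hcval j
  have he : ∀ a : A, e a = algebraMap A E a := by
    have h : (e.comp A.val.toRingHom).comp c.toRingHom = (algebraMap A E).comp c.toRingHom := by
      refine MvPolynomial.ringHom_ext (fun r => ?_) fun j => ?_
      · simp [e, c, MvPolynomial.algebraMap_eq]
      · have h1 : c (MvPolynomial.X j) = q.coeff (d - (j + 1)) := MvPolynomial.aeval_X _ _
        change e (c (MvPolynomial.X j) : A) = algebraMap A E (c (MvPolynomial.X j))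
        rw [h1, hqc, ← Polynomial.coeff_map, hPe, Polynomial.coeff_map]
    intro a
    obtain ⟨u, rfl⟩ := hc a
    exact RingHom.congr_fun h u
  refine ⟨{ toFun := fun u => ρ (e u)
            map_add' := fun u v => by rw [map_add, map_add]
            map_smul' := fun a u => ?_ }, ?_⟩
  · rw [Algebra.smul_def, map_mul]
    change ρ (e (a : MvPolynomial (Fin d) R) * e u) = _
    rw [he, ← Algebra.smul_def, map_smul]
    rfl
  · change ρ (e 1) = 1
    rw [map_one, hρ]

/-- A coefficient of a sum of products of homogeneous parts of `f` with polynomials `v_j`. -/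
lemma coeff_sum_homogeneousPart_mul {σ : Type*} [Finite σ] [DecidableEq σ]
    (f : MvPowerSeries σ R) (v : ℕ → MvPolynomial σ R) (γ : σ →₀ ℕ) :
    (∑ x ∈ Finset.HasAntidiagonal.antidiagonal γ.degree,
      homogeneousPart x.1 f * v x.2).coeff γ =
      ∑ y ∈ Finset.HasAntidiagonal.antidiagonal γ, coeff y.1 f * (v y.2.degree).coeff y.2 := by
  rw [MvPolynomial.coeff_sum]
  simp only [MvPolynomial.coeff_mul, coeff_homogeneousPart]
  rw [Finset.sum_comm]
  refine Finset.sum_congr rfl fun y hy => ?_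
  have hdeg : γ.degree = y.1.degree + y.2.degree := by
    rw [← Finset.HasAntidiagonal.mem_antidiagonal.1 hy, map_add]
  rw [Finset.sum_eq_single (y.1.degree, y.2.degree)]
  · simp
  · rintro ⟨a, b⟩ hab hne
    rw [if_neg, zero_mul]
    rintro rfl
    have h1 := Finset.HasAntidiagonal.mem_antidiagonal.1 hab
    simp only at h1
    exact hne (by rw [show b = y.2.degree by omega])
  · intro h
    exact (h (Finset.HasAntidiagonal.mem_antidiagonal.2 hdeg.symm)).elim

/-- The homogeneous parts of a product of power series. -/
lemma homogeneousPart_mul {σ : Type*} [Finite σ] (n : ℕ) (f g : MvPowerSeries σ R) :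
    homogeneousPart n (f * g) = ∑ x ∈ Finset.HasAntidiagonal.antidiagonal n,
      homogeneousPart x.1 f * homogeneousPart x.2 g := by
  classical
  ext γ
  rw [coeff_homogeneousPart]
  split_ifs with h
  · rw [← h, coeff_sum_homogeneousPart_mul f fun j => homogeneousPart j g, coeff_mul]
    simp [coeff_homogeneousPart]
  · refine (MvPolynomial.IsHomogeneous.coeff_eq_zero (n := n) ?_ h).symm
    refine MvPolynomial.IsHomogeneous.sum _ _ _ fun x hx => ?_
    have hhom : ∀ (m : ℕ) (u : MvPowerSeries σ R), (homogeneousPart m u).IsHomogeneous m := by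
      intro m u β hβ
      rw [coeff_homogeneousPart] at hβ
      by_contra hne
      rw [if_neg (by rwa [Finsupp.degree_eq_weight_one])] at hβ
      exact hβ rfl
    rw [← Finset.HasAntidiagonal.mem_antidiagonal.1 hx]
    exact (hhom _ _).mul (hhom _ _)

/-- The ring of power series retracts linearly onto the symmetric power series: the part of degree
`0` of a retraction of polynomial rings extends to power series. -/
theorem exists_retraction (F : FormalGroup R) (d : ℕ) :
    ∃ ρ : MvPowerSeries (Fin d) R →ₗ[F.divRing d] F.divRing d, ρ 1 = 1 := by
  classical
  let A := MvPolynomial.symmetricSubalgebra (Fin d) R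
  obtain ⟨ρ, hρ⟩ : ∃ ρ : MvPolynomial (Fin d) R →ₗ[A] A, ρ 1 = 1 :=
    exists_polynomial_retraction R d
  have hadd : ∀ (n : ℕ) (f g : MvPowerSeries (Fin d) R),
      homogeneousPart n (f + g) = homogeneousPart n f + homogeneousPart n g := by
    intro n f g
    ext γ
    simp only [coeff_homogeneousPart, MvPolynomial.coeff_add, map_add]
    split_ifs <;> simp
  let r : MvPowerSeries (Fin d) R → MvPowerSeries (Fin d) R := fun f γ =>
    (ρ (homogeneousPart γ.degree f) : MvPolynomial (Fin d) R).coeff γ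
  have hr : ∀ f γ, coeff γ (r f) =
      (ρ (homogeneousPart γ.degree f) : MvPolynomial (Fin d) R).coeff γ := fun _ _ => rfl
  have hmem : ∀ f, r f ∈ F.divRing d := by
    intro f σ
    change MvPowerSeries.rename σ (r f) = r f
    ext γ
    obtain ⟨β, rfl⟩ : ∃ β : Fin d →₀ ℕ, β.embDomain σ.toEmbedding = γ :=
      ⟨γ.embDomain σ.symm.toEmbedding, by ext i; simp [Finsupp.embDomain_eq_mapDomain,
        ← Finsupp.mapDomain_comp]⟩
    have h1 : β.embDomain σ.toEmbedding = β.mapDomain σ := Finsupp.embDomain_eq_mapDomain _ _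
    have h2 : coeff (β.embDomain σ.toEmbedding) (MvPowerSeries.rename σ (r f)) = coeff β (r f) :=
      coeff_embDomain_rename σ.toEmbedding (r f) β
    rw [h2, h1, hr, hr, Finsupp.degree_mapDomain]
    conv_rhs => rw [← (ρ (homogeneousPart β.degree f)).2 σ]
    rw [MvPolynomial.coeff_rename_mapDomain _ σ.injective]
  refine ⟨{ toFun := fun f => ⟨r f, hmem f⟩
            map_add' := fun f g => Subtype.ext ?_
            map_smul' := fun s f => Subtype.ext ?_ }, Subtype.ext ?_⟩
  · ext γ
    change coeff γ (r (f + g)) = coeff γ (r f + r g)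
    rw [map_add, hr, hr, hr, hadd, map_add]
    simp
  · change r ((s : MvPowerSeries (Fin d) R) * f) = (s : MvPowerSeries (Fin d) R) * r f
    ext γ
    have hs : ∀ i, ∀ u : MvPolynomial (Fin d) R,
        (ρ (homogeneousPart i (s : MvPowerSeries (Fin d) R) * u) : MvPolynomial (Fin d) R) =
          homogeneousPart i (s : MvPowerSeries (Fin d) R) * ρ u := by
      intro i u
      exact congrArg Subtype.val (ρ.map_smul
        (⟨homogeneousPart i (s : MvPowerSeries (Fin d) R),
          F.homogeneousPart_isSymmetric i s⟩ : A) u)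
    have hhom : homogeneousPart γ.degree ((s : MvPowerSeries (Fin d) R) * f) =
        ∑ x ∈ Finset.HasAntidiagonal.antidiagonal γ.degree,
          homogeneousPart x.1 (s : MvPowerSeries (Fin d) R) * homogeneousPart x.2 f :=
      homogeneousPart_mul _ _ _
    have h1 : (ρ (∑ x ∈ Finset.HasAntidiagonal.antidiagonal γ.degree,
          homogeneousPart x.1 (s : MvPowerSeries (Fin d) R) * homogeneousPart x.2 f) :
          MvPolynomial (Fin d) R) =
        ∑ x ∈ Finset.HasAntidiagonal.antidiagonal γ.degree,
          homogeneousPart x.1 (s : MvPowerSeries (Fin d) R) * ρ (homogeneousPart x.2 f) := by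
      rw [map_sum]
      change A.val _ = _
      rw [map_sum]
      exact Finset.sum_congr rfl fun x _ => hs _ _
    rw [hr, hhom, h1, coeff_sum_homogeneousPart_mul _
      (fun j => (ρ (homogeneousPart j f) : MvPolynomial (Fin d) R)), coeff_mul]
    rfl
  · ext γ
    change coeff γ (r 1) = coeff γ 1
    have h1 : homogeneousPart γ.degree (1 : MvPowerSeries (Fin d) R) =
        if γ.degree = 0 then 1 else 0 := by
      ext β
      rw [coeff_homogeneousPart, coeff_one]
      split_ifs with h2 h3 h4 h5 h6
      · simp [h3]
      · rw [h3] at h2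
        exact (h4 (h2 ▸ map_zero _)).elim
      · rw [h5] at h2
        exact (h3 ((Finsupp.degree_eq_zero_iff _).1 h2)).elim
      · simp
      · have h7 : (0 : Fin d →₀ ℕ) ≠ β := by
          rintro rfl
          exact h2 (by rw [h6, map_zero])
        rw [MvPolynomial.coeff_one, if_neg h7]
      · simp
    rw [hr, h1]
    split_ifs with h
    · rw [hρ, (Finsupp.degree_eq_zero_iff _).1 h]
      simp
    · have h2 : γ ≠ 0 := fun h3 => h (by rw [h3, map_zero])
      rw [map_zero, coeff_one, if_neg h2]
      simp

end FormalGroup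

/-! ### Multiplication by `k` on a formal group -/

namespace FormalGroup

open MvPowerSeries

section MulSeries

variable {R : Type*} [CommRing R] (F : FormalGroup R)

lemma hasSubst_pair {τ : Type*} {a b : MvPowerSeries τ R} (ha : PowerSeries.HasSubst a)
    (hb : PowerSeries.HasSubst b) : HasSubst ![a, b] :=
  hasSubst_of_constantCoeff_nilpotent fun s => by fin_cases s <;> simpa

/-- Substitution commutes with the sum of points. -/
lemma subst_pair_subst {σ τ : Type*} {a b : MvPowerSeries σ R} (ha : PowerSeries.HasSubst a)
    (hb : PowerSeries.HasSubst b) {c : σ → MvPowerSeries τ R} (hc : HasSubst c)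
    (G : MvPowerSeries (Fin 2) R) :
    (G.subst ![a, b]).subst c = G.subst ![a.subst c, b.subst c] := by
  rw [subst_comp_subst_apply (hasSubst_pair ha hb) hc]
  congr 1
  funext i
  fin_cases i <;> rfl

lemma mulSeries_zero : F.mulSeries 0 = 0 := by
  rw [mulSeries, zero_smul]
  rfl

lemma mulSeries_one : F.mulSeries 1 = PowerSeries.X := by
  rw [mulSeries, one_smul]
  rfl

lemma mulSeries_succ (k : ℕ) : F.mulSeries (k + 1) =
    F.toPowerSeries.subst ![(F.mulSeries k : MvPowerSeries Unit R), PowerSeries.X] := by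
  rw [mulSeries, succ_nsmul]
  rfl

/-- `[k]_F(x)` computes the multiples of all points. -/
lemma nsmul_val {σ : Type*} (k : ℕ) (x : F.Point σ) :
    (k • x).val = (F.mulSeries k).subst x.val := by
  have hx : PowerSeries.HasSubst x.val := x.2
  induction k with
  | zero =>
    rw [zero_smul, mulSeries_zero, ← PowerSeries.coe_substAlgHom hx, map_zero]
    rfl
  | succ k ih =>
    rw [succ_nsmul, add_apply, mulSeries_succ, PowerSeries.subst,
      subst_pair_subst (F.mulSeries_hasSubst k) PowerSeries.HasSubst.X' hx.const, ih]
    congr 2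
    exact congrArg (fun z : MvPowerSeries σ R => ![z]) (PowerSeries.subst_X (R := R) hx).symm

lemma mulSeries_mul (a b : ℕ) :
    F.mulSeries (a * b) = (F.mulSeries a).subst (F.mulSeries b) := by
  have h := F.nsmul_val a (b • F.coordPoint)
  rw [smul_smul] at h
  exact h

lemma constantCoeff_mulSeries (k : ℕ) : PowerSeries.constantCoeff (F.mulSeries k) = 0 := by
  induction k with
  | zero => rw [mulSeries_zero, map_zero]
  | succ k ih =>
    rw [mulSeries_succ]
    refine constantCoeff_subst_eq_zero (hasSubst_pair (F.mulSeries_hasSubst k)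
      PowerSeries.HasSubst.X') (fun i => ?_) F.zero_constantCoeff
    fin_cases i
    · exact ih
    · exact PowerSeries.constantCoeff_X

lemma mulSeries_map {S : Type*} [CommRing S] (f : R →+* S) (k : ℕ) :
    (F.map f).mulSeries k = PowerSeries.map f (F.mulSeries k) := by
  induction k with
  | zero => rw [mulSeries_zero, mulSeries_zero, map_zero]
  | succ k ih =>
    rw [mulSeries_succ, mulSeries_succ, ih, PowerSeries.map,
      map_subst (hasSubst_pair (F.mulSeries_hasSubst k) PowerSeries.HasSubst.X')]
    congr 1
    funext i
    fin_cases i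
    · rfl
    · exact (PowerSeries.map_X f).symm

/-- `[k]_F` is an endomorphism of the formal group. -/
lemma mulSeries_subst_toPowerSeries [F.IsComm] (k : ℕ) :
    (F.mulSeries k).subst F.toPowerSeries = F.toPowerSeries.subst
      ![(F.mulSeries k).subst (X 0 : MvPowerSeries (Fin 2) R),
        (F.mulSeries k).subst (X 1 : MvPowerSeries (Fin 2) R)] := by
  let x : F.Point (Fin 2) := ⟨X 0, PowerSeries.HasSubst.X 0⟩
  let y : F.Point (Fin 2) := ⟨X 1, PowerSeries.HasSubst.X 1⟩
  have hxy : (x + y).val = F.toPowerSeries := by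
    rw [add_apply]
    have : ![x.val, y.val] = (X : Fin 2 → MvPowerSeries (Fin 2) R) := by
      funext i
      fin_cases i <;> rfl
    rw [this, subst_self]
    rfl
  have h := congrArg Subtype.val (nsmul_add x y k)
  rw [add_apply, nsmul_val, nsmul_val, nsmul_val, hxy] at h
  exact h

lemma coeff_subst_X_zero (g : MvPowerSeries (Fin 2) R) (n : ℕ) :
    PowerSeries.coeff n (g.subst ![PowerSeries.X, (0 : PowerSeries R)]) =
      coeff (Finsupp.single 0 n) g := by
  rw [PowerSeries.coeff, coeff_subst (hasSubst_pair PowerSeries.HasSubst.X'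
    PowerSeries.HasSubst.zero'), finsum_eq_single _ (Finsupp.single 0 n)]
  · simp [PowerSeries.coeff_X_pow]
  · intro d hd
    by_cases hd₁ : d 1 = 0
    · have hd0 : d 0 ≠ n := by
        rintro rfl
        refine hd (Finsupp.ext fun i => ?_)
        fin_cases i <;> simp [hd₁]
      simp [hd₁, PowerSeries.coeff_X_pow, Ne.symm hd0]
    · simp [hd₁]

lemma coeff_subst_X_zero_mul_subst_X_one (f g : PowerSeries R) (e : Fin 2 →₀ ℕ) :
    coeff e (f.subst (X 0 : MvPowerSeries (Fin 2) R) * g.subst (X 1 : MvPowerSeries (Fin 2) R)) =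
      PowerSeries.coeff (e 0) f * PowerSeries.coeff (e 1) g := by
  rw [coeff_mul, Finset.sum_eq_single (Finsupp.single 0 (e 0), Finsupp.single 1 (e 1)) ?_ ?_]
  · grind [PowerSeries.coeff_subst_single]
  · intro b hb hb'
    by_contra hmul_ne_zero
    rcases ne_zero_and_ne_zero_of_mul hmul_ne_zero with ⟨h0, h1⟩
    simp only [Fin.isValue, PowerSeries.coeff_subst_single, ne_eq, ite_eq_right_iff,
      not_forall, exists_prop] at h0 h1
    apply hb'
    rw [Prod.ext_iff, ← Finset.HasAntidiagonal.mem_antidiagonal.mp hb, h0.1, h1.1]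
    simp
  · intro he
    have he' : Finsupp.single 0 (e 0) + Finsupp.single 1 (e 1) = e := by
      ext i
      fin_cases i <;> simp
    exact absurd (Finset.HasAntidiagonal.mem_antidiagonal.mpr he') he

/-- The linear coefficient of `[k]_F` is `k`. -/
lemma coeff_one_mulSeries (k : ℕ) : PowerSeries.coeff 1 (F.mulSeries k) = k := by
  induction k with
  | zero => simp [mulSeries_zero]
  | succ k ih =>
    obtain ⟨u, hu⟩ := PowerSeries.X_dvd_iff.2 (F.constantCoeff_mulSeries k)
    have hterm : ∀ β : Fin 2 →₀ ℕ, coeff (Finsupp.single () 1)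
        (β.prod fun s e => ![F.mulSeries k, (PowerSeries.X : PowerSeries R)] s ^ e) =
        PowerSeries.coeff 1 (PowerSeries.X ^ (β 0 + β 1) * u ^ β 0) := by
      intro β
      rw [Finsupp.prod_fintype _ _ (fun i => pow_zero _), Fin.prod_univ_two]
      change PowerSeries.coeff 1 (F.mulSeries k ^ β 0 * PowerSeries.X ^ β 1) = _
      rw [hu]
      ring_nf
    have h0 : (Finsupp.single (0 : Fin 2) 1 : Fin 2 →₀ ℕ) ≠ Finsupp.single 1 1 := by
      intro h
      have := DFunLike.congr_fun h 0
      simp at this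
    rw [mulSeries_succ, PowerSeries.coeff, coeff_subst (hasSubst_pair (F.mulSeries_hasSubst k)
      PowerSeries.HasSubst.X'), finsum_eq_sum_of_support_subset
      (s := {Finsupp.single 0 1, Finsupp.single 1 1}), Finset.sum_pair h0, hterm, hterm,
      F.lin_coeff_X, F.lin_coeff_Y]
    · have h1 : PowerSeries.coeff 1 (PowerSeries.X * u) = (k : R) := by rw [← hu, ih]
      simp [h1]
    · intro β hβ
      rw [Function.mem_support, hterm, PowerSeries.coeff_X_pow_mul'] at hβ
      have hle : β 0 + β 1 ≤ 1 := by
        by_contra hcon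
        rw [if_neg hcon] at hβ
        simp at hβ
      have hne : β ≠ 0 := by
        rintro rfl
        rw [coeff_zero_eq_constantCoeff, F.zero_constantCoeff] at hβ
        simp at hβ
      simp only [Finset.coe_insert, Finset.coe_singleton, Set.mem_insert_iff,
        Set.mem_singleton_iff]
      have hne' : β 0 ≠ 0 ∨ β 1 ≠ 0 := by
        by_contra! hcon
        exact hne (Finsupp.ext fun i => by fin_cases i <;> simp [hcon.1, hcon.2])
      rcases Nat.eq_zero_or_pos (β 0) with h | h
      · right
        ext i
        fin_cases i
        · simpa using h
        · simp
          omega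
      · left
        ext i
        fin_cases i
        · simp
          omega
        · simp
          omega

end MulSeries

section Height

variable {K : Type*} [Field K]

/-- If `h` is a homomorphism of formal groups over a field of characteristic `p` with derivative
zero at the origin, then `h` is a power series in `x ^ p`: for the first exponent `i` prime to `p`,
the coefficients of `x ^ (i - 1) y` in `h(G(x, y)) = H(h(x), h(y))` do not match. -/
lemma exists_expand_eq_of_hom (p : ℕ) [Fact p.Prime] [CharP K p] (G H : FormalGroup K)
    {h : PowerSeries K} (h0 : PowerSeries.constantCoeff h = 0) (h1 : PowerSeries.coeff 1 h = 0)
    (hom : h.subst G.toPowerSeries = H.toPowerSeries.subst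
      ![h.subst (X 0 : MvPowerSeries (Fin 2) K), h.subst (X 1 : MvPowerSeries (Fin 2) K)]) :
    ∃ g : PowerSeries K, h = PowerSeries.expand p (NeZero.ne p) g := by
  have hG : PowerSeries.HasSubst G.toPowerSeries :=
    PowerSeries.HasSubst.of_constantCoeff_zero G.zero_constantCoeff
  have hX0 := PowerSeries.HasSubst.X (S := K) (0 : Fin 2)
  have hX1 := PowerSeries.HasSubst.X (S := K) (1 : Fin 2)
  have hc : ∀ i : Fin 2, constantCoeff (h.subst (X i : MvPowerSeries (Fin 2) K)) = 0 := fun i =>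
    PowerSeries.constantCoeff_subst_eq_zero (constantCoeff_X i) h h0
  have hpair := hasSubst_pair (PowerSeries.HasSubst.of_constantCoeff_zero (hc 0))
    (PowerSeries.HasSubst.of_constantCoeff_zero (hc 1))
  let e : ℕ → Fin 2 →₀ ℕ := fun n => Finsupp.single 0 n + Finsupp.single 1 1
  -- the right-hand side has no terms linear in `y`
  have hright : ∀ n, coeff (e n) (h.subst G.toPowerSeries) = 0 := by
    intro n
    rw [hom, coeff_subst hpair]
    refine finsum_eq_zero_of_forall_eq_zero fun β => ?_
    rw [Finsupp.prod_fintype _ _ (fun i => pow_zero _), Fin.prod_univ_two]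
    simp only [Matrix.cons_val_zero, Matrix.cons_val_one, Matrix.cons_val_fin_one]
    rw [← PowerSeries.subst_pow hX0, ← PowerSeries.subst_pow hX1,
      coeff_subst_X_zero_mul_subst_X_one]
    have he1 : e n 1 = 1 := by simp [e]
    have hz : PowerSeries.coeff 1 (h ^ β 1) = 0 := by
      rcases Nat.lt_or_ge 1 (β 1) with hb | hb
      · refine PowerSeries.coeff_of_lt_order _ ?_
        have h2 : ((β 1 : ℕ) : ℕ∞) ≤ (h ^ β 1).order :=
          PowerSeries.le_order_pow_of_constantCoeff_eq_zero _ h0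
        exact lt_of_lt_of_le (by exact_mod_cast hb) h2
      · interval_cases hb' : β 1
        · simp [PowerSeries.coeff_one]
        · simpa using h1
    rw [he1, hz, mul_zero, smul_zero]
  -- the terms linear in `y` of the powers of `G`
  let u : PowerSeries K := (pderiv K 1 G.toPowerSeries).subst ![PowerSeries.X, (0 : PowerSeries K)]
  have hsub := hasSubst_pair (PowerSeries.HasSubst.X' (R := K))
    (PowerSeries.HasSubst.zero' (R := K))
  have hGX : G.toPowerSeries.subst ![PowerSeries.X, (0 : PowerSeries K)] = PowerSeries.X :=
    G.Xzero_eq_X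
  have hlin : ∀ (g : MvPowerSeries (Fin 2) K) n, coeff (e n) g =
      PowerSeries.coeff n ((pderiv K 1 g).subst ![PowerSeries.X, (0 : PowerSeries K)]) := by
    intro g n
    rw [coeff_subst_X_zero, coeff_pderiv]
    simp [e]
  have hu0 : PowerSeries.coeff 0 u = 1 := by
    rw [← hlin, ← G.lin_coeff_Y]
    simp [e]
  have hleft : ∀ j n : ℕ, coeff (e n) (G.toPowerSeries ^ j) =
      (j : K) * PowerSeries.coeff n (PowerSeries.X ^ (j - 1) * u) := by
    intro j n
    rw [hlin, pderiv_pow, ← substAlgHom_apply hsub, map_mul (substAlgHom hsub),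
      map_mul (substAlgHom hsub), map_natCast, map_pow]
    simp only [substAlgHom_apply]
    rw [hGX, mul_assoc, ← map_natCast (PowerSeries.C (R := K)), PowerSeries.coeff_C_mul]
  have hzero : ∀ i, ¬ p ∣ i → PowerSeries.coeff i h = 0 := by
    intro i
    induction i using Nat.strong_induction_on with
    | _ i ih =>
      intro hi
      have hi0 : 0 < i := Nat.pos_of_ne_zero fun h => hi (h ▸ dvd_zero p)
      have hsum := hright (i - 1)
      rw [PowerSeries.coeff_subst hG, finsum_eq_single _ i] at hsum
      · rw [hleft, PowerSeries.coeff_X_pow_mul', if_pos le_rfl, Nat.sub_self, hu0, mul_one,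
          smul_eq_mul] at hsum
        have : (i : K) ≠ 0 := fun hk => hi ((CharP.cast_eq_zero_iff K p i).1 hk)
        exact (mul_eq_zero.1 hsum).resolve_right this
      · intro j hj
        rw [hleft]
        by_cases hpj : p ∣ j
        · rw [(CharP.cast_eq_zero_iff K p j).2 hpj, zero_mul, smul_zero]
        · rcases lt_or_gt_of_ne hj with hlt | hgt
          · rw [ih j hlt hpj, zero_smul]
          · rw [PowerSeries.coeff_X_pow_mul', if_neg (by omega), mul_zero, smul_zero]
  refine ⟨PowerSeries.mk fun m => PowerSeries.coeff (p * m) h, ?_⟩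
  ext i
  rw [PowerSeries.coeff_expand]
  split_ifs with hi
  · rw [PowerSeries.coeff_mk, Nat.mul_div_cancel' hi]
  · exact hzero i hi

/-- If `h(x ^ q)` is an endomorphism of `F` and `q` is a power of the characteristic, then `h` is a
homomorphism to `F` from its Frobenius twist. -/
lemma hom_of_expand_hom (p : ℕ) [Fact p.Prime] [CharP K p] (F : FormalGroup K) (j : ℕ)
    {h : PowerSeries K} (h0 : PowerSeries.constantCoeff h = 0)
    (hom : (PowerSeries.expand (p ^ j) (NeZero.ne _) h).subst F.toPowerSeries =
      F.toPowerSeries.subst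
        ![(PowerSeries.expand (p ^ j) (NeZero.ne _) h).subst (X 0 : MvPowerSeries (Fin 2) K),
          (PowerSeries.expand (p ^ j) (NeZero.ne _) h).subst (X 1 : MvPowerSeries (Fin 2) K)]) :
    h.subst (F.frobTwist p j).toPowerSeries = F.toPowerSeries.subst
      ![h.subst (X 0 : MvPowerSeries (Fin 2) K), h.subst (X 1 : MvPowerSeries (Fin 2) K)] := by
  have hq : p ^ j ≠ 0 := NeZero.ne _
  have hexp : ∀ a : MvPowerSeries (Fin 2) K, PowerSeries.HasSubst a →
      (PowerSeries.expand (p ^ j) hq h).subst a = h.subst (a ^ p ^ j) := by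
    intro a ha
    rw [PowerSeries.expand_apply, PowerSeries.subst_comp_subst_apply
      (PowerSeries.HasSubst.X_pow hq) ha, PowerSeries.subst_pow ha, PowerSeries.subst_X ha]
  have hc : ∀ i : Fin 2, PowerSeries.HasSubst (h.subst (X i : MvPowerSeries (Fin 2) K)) := fun i =>
    PowerSeries.HasSubst.of_constantCoeff_zero
      (PowerSeries.constantCoeff_subst_eq_zero (constantCoeff_X i) h h0)
  have hpow : F.toPowerSeries ^ p ^ j =
      expand (p ^ j) hq (F.frobTwist p j).toPowerSeries := by
    rw [← map_iterateFrobenius_expand p (NeZero.ne p), map_expand]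
    rfl
  have hX : ∀ i : Fin 2, (PowerSeries.expand (p ^ j) hq h).subst (X i : MvPowerSeries (Fin 2) K) =
      expand (p ^ j) hq (h.subst (X i : MvPowerSeries (Fin 2) K)) := by
    intro i
    rw [hexp _ (PowerSeries.HasSubst.X i), PowerSeries.expand_subst _ hq (PowerSeries.HasSubst.X i),
      expand_X]
  have hF : PowerSeries.HasSubst F.toPowerSeries :=
    PowerSeries.HasSubst.of_constantCoeff_zero F.zero_constantCoeff
  have hF' : PowerSeries.HasSubst (F.frobTwist p j).toPowerSeries :=
    PowerSeries.HasSubst.of_constantCoeff_zero (F.frobTwist p j).zero_constantCoeff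
  rw [hexp _ hF, hpow, ← PowerSeries.expand_subst _ hq hF', hX, hX] at hom
  have hpair : ![expand (p ^ j) hq (h.subst (X 0 : MvPowerSeries (Fin 2) K)),
      expand (p ^ j) hq (h.subst (X 1 : MvPowerSeries (Fin 2) K))] = fun i => expand (p ^ j) hq
        (![h.subst (X 0 : MvPowerSeries (Fin 2) K),
          h.subst (X 1 : MvPowerSeries (Fin 2) K)] i) := by
    funext i
    fin_cases i <;> rfl
  rw [hpair, ← expand_subst _ hq (hasSubst_pair (hc 0) (hc 1))] at hom
  ext γ
  have := congrArg (coeff ((p ^ j) • γ)) hom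
  rwa [coeff_expand_smul, coeff_expand_smul] at this

/-- A formal group law of finite height over a field lives in characteristic `p`. -/
lemma HasHeight.charP {F : FormalGroup K} {p n : ℕ} [Fact p.Prime] (hn : 1 ≤ n)
    (hF : F.HasHeight p n) : CharP K p := by
  have hp : 1 < p := (Fact.out : p.Prime).one_lt
  have h1 : PowerSeries.coeff 1 (F.mulSeries p) = 0 := by
    refine PowerSeries.coeff_of_lt_order _ ?_
    rw [show (F.mulSeries p).order = _ from hF]
    exact_mod_cast Nat.one_lt_pow (by omega) hp
  rw [coeff_one_mulSeries] at h1
  exact (CharP.charP_iff_prime_eq_zero Fact.out).2 h1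

/-- Over a field, `[p]_F` is an invertible power series in `x ^ (p ^ n)` if `F` has height `n`. -/
lemma HasHeight.exists_mulSeries_eq_expand {F : FormalGroup K} [F.IsComm] {p n : ℕ}
    [Fact p.Prime] [CharP K p] (hF : F.HasHeight p n) :
    ∃ h : PowerSeries K, PowerSeries.constantCoeff h = 0 ∧ PowerSeries.coeff 1 h ≠ 0 ∧
      F.mulSeries p = PowerSeries.expand (p ^ n) (NeZero.ne _) h := by
  have hp : 1 < p := (Fact.out : p.Prime).one_lt
  have key : ∀ j ≤ n, ∃ h : PowerSeries K,
      F.mulSeries p = PowerSeries.expand (p ^ j) (NeZero.ne _) h := by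
    intro j
    induction j with
    | zero => exact fun _ => ⟨F.mulSeries p, by simp⟩
    | succ j ih =>
      intro hj
      obtain ⟨h, hh⟩ := ih (by omega)
      have h0 : PowerSeries.constantCoeff h = 0 := by
        rw [← PowerSeries.constantCoeff_expand (p ^ j) (NeZero.ne _), ← hh, constantCoeff_mulSeries]
      have h1 : PowerSeries.coeff 1 h = 0 := by
        rw [← PowerSeries.coeff_expand_mul (p ^ j) (NeZero.ne _) h 1, ← hh]
        refine PowerSeries.coeff_of_lt_order _ ?_
        rw [show (F.mulSeries p).order = _ from hF, mul_one]
        exact_mod_cast Nat.pow_lt_pow_right hp (by omega)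
      have hom := F.mulSeries_subst_toPowerSeries p
      rw [hh] at hom
      obtain ⟨g, hg⟩ := exists_expand_eq_of_hom p _ _ h0 h1 (hom_of_expand_hom p F j h0 hom)
      refine ⟨g, ?_⟩
      rw [hh, hg, ← PowerSeries.expand_mul]
      congr 1
  obtain ⟨h, hh⟩ := key n le_rfl
  refine ⟨h, ?_, ?_, hh⟩
  · rw [← PowerSeries.constantCoeff_expand (p ^ n) (NeZero.ne _), ← hh, constantCoeff_mulSeries]
  · rw [← PowerSeries.coeff_expand_mul (p ^ n) (NeZero.ne _) h 1, ← hh, mul_one]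
    exact (PowerSeries.order_eq_nat.1 hF).1

lemma coeff_one_subst {f g : PowerSeries K} (hg : PowerSeries.constantCoeff g = 0) :
    PowerSeries.coeff 1 (f.subst g) = PowerSeries.coeff 1 f * PowerSeries.coeff 1 g := by
  rw [PowerSeries.coeff_subst' (PowerSeries.HasSubst.of_constantCoeff_zero' hg),
    finsum_eq_single _ 1]
  · simp
  · intro j hj
    rcases Nat.eq_zero_or_pos j with rfl | hj0
    · simp [PowerSeries.coeff_one]
    · rw [PowerSeries.coeff_of_lt_order 1, smul_zero]
      exact lt_of_lt_of_le (by exact_mod_cast (show 1 < j by omega))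
        (PowerSeries.le_order_pow_of_constantCoeff_eq_zero j hg)

/-- Over a field, `[p ^ v]_F` is an invertible power series in `x ^ (p ^ (n * v))` if `F` has
height `n`. -/
theorem HasHeight.exists_mulSeries_pow_eq_expand {F : FormalGroup K} [F.IsComm] {p n : ℕ}
    [Fact p.Prime] [CharP K p] (hF : F.HasHeight p n) (v : ℕ) :
    ∃ h : PowerSeries K, PowerSeries.constantCoeff h = 0 ∧ PowerSeries.coeff 1 h ≠ 0 ∧
      F.mulSeries (p ^ v) = PowerSeries.expand (p ^ (n * v)) (NeZero.ne _) h := by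
  obtain ⟨h, h0, h1, hh⟩ := hF.exists_mulSeries_eq_expand
  induction v with
  | zero =>
    refine ⟨PowerSeries.X, PowerSeries.constantCoeff_X, ?_, ?_⟩
    · simp
    · rw [pow_zero, mulSeries_one, PowerSeries.expand_X]
      simp
  | succ v ih =>
    obtain ⟨g, g0, g1, hg⟩ := ih
    -- `h (g (x ^ q) ^ (p ^ n))` is a series in `x ^ (q * p ^ n)`, since raising `g` to the power
    -- `p ^ n` amounts to doing so with the variable and the coefficients
    let g' : PowerSeries K := PowerSeries.map (iterateFrobenius K p n) g
    have hg'0 : PowerSeries.constantCoeff g' = 0 := by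
      rw [← PowerSeries.coeff_zero_eq_constantCoeff_apply, PowerSeries.coeff_map,
        PowerSeries.coeff_zero_eq_constantCoeff_apply, g0, map_zero]
    have hg' : PowerSeries.HasSubst g' := PowerSeries.HasSubst.of_constantCoeff_zero' hg'0
    refine ⟨h.subst g', ?_, ?_, ?_⟩
    · exact PowerSeries.constantCoeff_subst_eq_zero hg'0 h h0
    · rw [coeff_one_subst hg'0]
      refine mul_ne_zero h1 ?_
      rw [PowerSeries.coeff_map, iterateFrobenius_def]
      exact pow_ne_zero _ g1
    · have hs := F.mulSeries_hasSubst (p ^ v)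
      have hpow : ∀ f : PowerSeries K, f ^ p ^ n = PowerSeries.expand (p ^ n) (NeZero.ne _)
          (PowerSeries.map (iterateFrobenius K p n) f) := by
        intro f
        rw [← PowerSeries.map_expand]
        exact (map_iterateFrobenius_expand p (NeZero.ne p) f n).symm
      rw [pow_succ', mulSeries_mul, hh, PowerSeries.expand_apply,
        PowerSeries.subst_comp_subst_apply (PowerSeries.HasSubst.X_pow (NeZero.ne _)) hs,
        PowerSeries.subst_pow hs, PowerSeries.subst_X hs, hpow, hg, PowerSeries.map_expand,
        ← PowerSeries.expand_mul]
      have hcongr : ∀ (a b : ℕ) (ha : a ≠ 0) (hb : b ≠ 0) (f : PowerSeries K), a = b →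
          PowerSeries.expand a ha f = PowerSeries.expand b hb f := by
        rintro a b ha hb f rfl
        rfl
      rw [hcongr _ (p ^ (n * (v + 1))) _ (NeZero.ne _) _ (by ring)]
      exact (PowerSeries.expand_subst _ _ hg' h).symm

end Height

end FormalGroup

/-! ### The ideal of `Z(v, d)` -/

namespace FormalGroup

open MvPowerSeries

section Pull

variable {R : Type*} [CommRing R]

/-- The series `φ(x_i)` in the coordinates of `𝔾^d`. -/
abbrev coordSeries (φ : PowerSeries R) (d : ℕ) (i : Fin d) : MvPowerSeries (Fin d) R :=
  φ.subst (X i : MvPowerSeries (Fin d) R)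

variable {φ ψ : PowerSeries R}

lemma constantCoeff_coordSeries (hφ : PowerSeries.constantCoeff φ = 0) (d : ℕ) (i : Fin d) :
    constantCoeff (coordSeries φ d i) = 0 :=
  PowerSeries.constantCoeff_subst_eq_zero (constantCoeff_X i) φ hφ

lemma coordSeries_hasSubst (hφ : PowerSeries.constantCoeff φ = 0) (d : ℕ) :
    HasSubst (coordSeries φ d) :=
  hasSubst_of_constantCoeff_zero fun i => constantCoeff_coordSeries hφ d i

/-- The ring map of the `d`-fold power of the self-map `φ` of the formal line `𝔾`. -/
def seriesPull (hφ : PowerSeries.constantCoeff φ = 0) (d : ℕ) :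
    MvPowerSeries (Fin d) R →ₐ[R] MvPowerSeries (Fin d) R :=
  substAlgHom (coordSeries_hasSubst hφ d)

lemma seriesPull_apply (hφ : PowerSeries.constantCoeff φ = 0) (d : ℕ)
    (f : MvPowerSeries (Fin d) R) : seriesPull hφ d f = f.subst (coordSeries φ d) :=
  substAlgHom_apply _ _

lemma rename_coordSeries (d : ℕ) (σ : Equiv.Perm (Fin d)) (i : Fin d) :
    MvPowerSeries.rename σ (coordSeries φ d i) = coordSeries φ d (σ i) := by
  have hX := HasSubst.X_comp (R := R) (f := σ)
  rw [rename_eq_subst, coordSeries, PowerSeries.subst,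
    subst_comp_subst_apply (PowerSeries.HasSubst.X i).const hX]
  congr 1
  funext _
  exact subst_X hX i

lemma rename_seriesPull (hφ : PowerSeries.constantCoeff φ = 0) (d : ℕ) (σ : Equiv.Perm (Fin d))
    (f : MvPowerSeries (Fin d) R) :
    MvPowerSeries.rename σ (seriesPull hφ d f) =
      seriesPull hφ d (MvPowerSeries.rename σ f) := by
  have hX := HasSubst.X_comp (R := R) (f := σ)
  rw [seriesPull_apply, seriesPull_apply, rename_eq_subst, rename_eq_subst,
    subst_comp_subst_apply (coordSeries_hasSubst hφ d) hX,
    subst_comp_subst_apply hX (coordSeries_hasSubst hφ d)]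
  congr 1
  funext i
  rw [← rename_eq_subst, rename_coordSeries]
  exact (subst_X (coordSeries_hasSubst hφ d) (σ i)).symm

/-- The ring map of the self-map of `Div_d^+(𝔾)` induced by the self-map `φ` of `𝔾`. -/
def pullDiv (F : FormalGroup R) (hφ : PowerSeries.constantCoeff φ = 0) (d : ℕ) :
    F.divRing d →ₐ[R] F.divRing d :=
  ((seriesPull hφ d).comp (F.divRing d).val).codRestrict (F.divRing d) fun f σ => by
    change MvPowerSeries.rename σ (seriesPull hφ d (f : MvPowerSeries (Fin d) R)) = _
    rw [rename_seriesPull]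
    exact congrArg (seriesPull hφ d) (f.2 σ)

lemma coe_pullDiv (F : FormalGroup R) (hφ : PowerSeries.constantCoeff φ = 0) (d : ℕ)
    (f : F.divRing d) : (F.pullDiv hφ d f : MvPowerSeries (Fin d) R) = seriesPull hφ d f := rfl

/-- A composition of power series pulls back as the composition of the pullbacks. -/
lemma seriesPull_seriesPull (hφ : PowerSeries.constantCoeff φ = 0)
    (hψ : PowerSeries.constantCoeff ψ = 0) (hc : PowerSeries.constantCoeff (ψ.subst φ) = 0) (d : ℕ)
    (f : MvPowerSeries (Fin d) R) :
    seriesPull hφ d (seriesPull hψ d f) = seriesPull hc d f := by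
  rw [seriesPull_apply, seriesPull_apply, seriesPull_apply,
    subst_comp_subst_apply (coordSeries_hasSubst hψ d) (coordSeries_hasSubst hφ d)]
  congr 1
  funext i
  have hs := coordSeries_hasSubst hφ d
  have hφs : PowerSeries.HasSubst φ := PowerSeries.HasSubst.of_constantCoeff_zero' hφ
  rw [coordSeries, PowerSeries.subst, subst_comp_subst_apply (PowerSeries.HasSubst.X i).const hs]
  have h1 : (fun _ : Unit => (X i : MvPowerSeries (Fin d) R).subst (coordSeries φ d)) =
      fun _ => coordSeries φ d i := funext fun _ => subst_X hs i
  rw [h1]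
  exact (PowerSeries.subst_comp_subst_apply hφs (PowerSeries.HasSubst.X i) ψ).symm

lemma psi_eq_pullDiv (F : FormalGroup R) (k d : ℕ) :
    F.psi k d = F.pullDiv (F.constantCoeff_mulSeries k) d := rfl

lemma zeroDiv_apply (F : FormalGroup R) (d : ℕ) (f : F.divRing d) :
    F.zeroDiv d f = constantCoeff (f : MvPowerSeries (Fin d) R) := rfl

lemma zeroDiv_chern (F : FormalGroup R) (d : ℕ) (j : Fin d) : F.zeroDiv d (F.chern d j) = 0 := by
  rw [zeroDiv_apply, chern_coe, ← coeff_zero_eq_constantCoeff_apply, MvPolynomial.coeff_coe]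
  exact (chernPoly_isHomogeneous d j).coeff_eq_zero (by simp)

lemma chernMap_X (F : FormalGroup R) (d : ℕ) (j : Fin d) : F.chernMap d (X j) = F.chern d j :=
  Subtype.ext (substAlgHom_X (F.chern_hasSubst d) j)

lemma zeroDiv_pullDiv (F : FormalGroup R) (hφ : PowerSeries.constantCoeff φ = 0) (d : ℕ)
    (f : F.divRing d) : F.zeroDiv d (F.pullDiv hφ d f) = F.zeroDiv d f := by
  have h := subst_sub_C_mem_span (coordSeries_hasSubst hφ d) (f : MvPowerSeries (Fin d) R)
  rw [Ideal.mem_span_range_iff_exists_fun] at h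
  obtain ⟨c, hc⟩ := h
  have h1 := congrArg constantCoeff hc
  simp only [map_sum, map_mul, constantCoeff_coordSeries hφ, mul_zero, Finset.sum_const_zero,
    map_sub, constantCoeff_C] at h1
  rw [zeroDiv_apply, zeroDiv_apply, coe_pullDiv, seriesPull_apply]
  exact (sub_eq_zero.1 h1.symm)

/-- Modulo its value at `d[0]`, a function on `Div_d^+(𝔾)` is a combination of the `c_j`. -/
lemma chernMap_eq_add (F : FormalGroup R) (d : ℕ) (g : MvPowerSeries (Fin d) R) :
    ∃ u : Fin d → MvPowerSeries (Fin d) R, F.chernMap d g = algebraMap R _ (constantCoeff g) +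
      ∑ j, F.chern d j * F.chernMap d (u j) := by
  obtain ⟨u, hu⟩ := exists_sum_X_mul_of_constantCoeff_eq_zero
    (f := g - C (constantCoeff g)) (by simp)
  refine ⟨u, ?_⟩
  rw [sub_eq_iff_eq_add'] at hu
  conv_lhs => rw [hu]
  rw [map_add, c_eq_algebraMap, AlgHom.commutes, map_sum]
  simp_rw [map_mul, chernMap_X]

lemma zeroDiv_chernMap (F : FormalGroup R) (d : ℕ) (g : MvPowerSeries (Fin d) R) :
    F.zeroDiv d (F.chernMap d g) = constantCoeff g := by
  obtain ⟨u, hg⟩ := F.chernMap_eq_add d g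
  rw [hg, map_add, AlgHom.commutes, map_sum]
  simp [zeroDiv_chern]

/-- The equation `φ_* D = d[0]` for divisors `D` is imposed by the coordinate functions. -/
lemma pullDiv_sub_mem_span (F : FormalGroup R) (hφ : PowerSeries.constantCoeff φ = 0) (d : ℕ)
    (f : F.divRing d) : F.pullDiv hφ d f - algebraMap R _ (F.zeroDiv d f) ∈
      Ideal.span (Set.range fun j => F.pullDiv hφ d (F.chern d j)) := by
  obtain ⟨g, rfl⟩ := (F.chernMap_bijective d).2 f
  obtain ⟨u, hg⟩ := F.chernMap_eq_add d g
  rw [zeroDiv_chernMap, hg, map_add, AlgHom.commutes, add_sub_cancel_left, map_sum]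
  refine Ideal.sum_mem _ fun j _ => ?_
  rw [map_mul]
  exact Ideal.mul_mem_right _ _ (Ideal.subset_span ⟨j, rfl⟩)

/-- The ideal of `Z(v, d)` does not change when `[p ^ v]_F` is replaced by its composite with a
change of coordinate, and it is generated by the pullbacks of the `c_j`. -/
theorem zIdeal_eq_span (F : FormalGroup R) (p v d : ℕ) {h : PowerSeries R}
    (hφ : PowerSeries.constantCoeff φ = 0) (h0 : PowerSeries.constantCoeff h = 0)
    (h1 : IsUnit (PowerSeries.coeff 1 h)) (hF : F.mulSeries (p ^ v) = h.subst φ) :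
    F.zIdeal p v d = Ideal.span (Set.range fun j => F.pullDiv hφ d (F.chern d j)) := by
  have hc : PowerSeries.constantCoeff (h.subst φ) = 0 := hF ▸ F.constantCoeff_mulSeries _
  have hpsi : ∀ f, F.psi (p ^ v) d f = F.pullDiv hφ d (F.pullDiv h0 d f) := by
    intro f
    refine Subtype.ext ?_
    rw [coe_pullDiv, coe_pullDiv, seriesPull_seriesPull hφ h0 hc, psi_eq_pullDiv, coe_pullDiv]
    simp only [seriesPull_apply]
    rw [hF]
  refine le_antisymm ?_ ?_
  · refine Ideal.span_le.2 ?_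
    rintro _ ⟨f, rfl⟩
    change F.psi (p ^ v) d f - algebraMap R _ (F.zeroDiv d f) ∈ _
    rw [hpsi, ← F.zeroDiv_pullDiv h0 d f]
    exact F.pullDiv_sub_mem_span hφ d _
  · refine Ideal.span_le.2 ?_
    rintro _ ⟨j, rfl⟩
    have hi0 : PowerSeries.constantCoeff (h.substInvOfIsUnit h1) = 0 :=
      PowerSeries.constantCoeff_substInvOfIsUnit h h1
    have hX : (h.substInvOfIsUnit h1).subst h = PowerSeries.X :=
      PowerSeries.subst_substInvOfIsUnit_left h h0 h1
    refine Ideal.subset_span ⟨F.pullDiv hi0 d (F.chern d j), ?_⟩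
    change F.psi (p ^ v) d _ - algebraMap R _ _ = _
    rw [zeroDiv_pullDiv, zeroDiv_chern, map_zero, sub_zero, hpsi]
    congr 1
    refine Subtype.ext ?_
    rw [coe_pullDiv, coe_pullDiv, seriesPull_seriesPull h0 hi0 (by rw [hX]; simp),
      seriesPull_apply]
    have hid : coordSeries ((h.substInvOfIsUnit h1).subst h) d = X := by
      funext i
      rw [hX]
      exact PowerSeries.subst_X (PowerSeries.HasSubst.X i)
    rw [hid, subst_self]
    rfl

end Pull

end FormalGroup

/-! ### The scheme `Z(v, d)` in the coordinates `c_j` -/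

namespace FormalGroup

open MvPowerSeries

section Coordinates

variable {R : Type*} [CommRing R]

instance map_isComm {S : Type*} [CommRing S] (F : FormalGroup R) [F.IsComm] (f : R →+* S) :
    (F.map f).IsComm where
  comm := by
    have h := congrArg (MvPowerSeries.map f) (IsComm.comm (F := F))
    rw [MvPowerSeries.map_subst (hasSubst_pair (PowerSeries.HasSubst.X 1)
      (PowerSeries.HasSubst.X 0))] at h
    refine h.trans ?_
    congr 1
    funext i
    fin_cases i <;> simp

/-- Over a local base, `[p ^ v]_F` is the composite of an invertible series with a lift of the
power `x ^ (p ^ (n * v))`. -/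
theorem exists_mulSeries_eq_subst [IsLocalRing R] (F : FormalGroup R) [F.IsComm] {p n : ℕ}
    [Fact p.Prime] (hn : 1 ≤ n) (hF : (F.map (IsLocalRing.residue R)).HasHeight p n) (v : ℕ) :
    ∃ h φ : PowerSeries R, PowerSeries.constantCoeff h = 0 ∧ IsUnit (PowerSeries.coeff 1 h) ∧
      PowerSeries.constantCoeff φ = 0 ∧
      PowerSeries.map (IsLocalRing.residue R) φ = PowerSeries.X ^ p ^ (n * v) ∧
      F.mulSeries (p ^ v) = h.subst φ := by
  have := hF.charP hn
  obtain ⟨g, g0, g1, hg⟩ := hF.exists_mulSeries_pow_eq_expand v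
  -- a lift of `g` that still has no constant term, so that it can be inverted under composition
  choose s hs using IsLocalRing.residue_surjective (R := R)
  let h : PowerSeries R := PowerSeries.mk fun k => if k = 0 then 0 else s (PowerSeries.coeff k g)
  have h0 : PowerSeries.constantCoeff h = 0 := by
    rw [← PowerSeries.coeff_zero_eq_constantCoeff_apply]
    simp [h]
  have hmap : PowerSeries.map (IsLocalRing.residue R) h = g := by
    ext k
    rw [PowerSeries.coeff_map, PowerSeries.coeff_mk]
    split_ifs with hk
    · rw [hk, map_zero, PowerSeries.coeff_zero_eq_constantCoeff_apply, g0]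
    · exact hs _
  have h1 : IsUnit (PowerSeries.coeff 1 h) := by
    rw [← IsLocalRing.residue_ne_zero_iff_isUnit, ← PowerSeries.coeff_map, hmap]
    exact g1
  have hc := F.constantCoeff_mulSeries (p ^ v)
  have hs' := PowerSeries.HasSubst.of_constantCoeff_zero' hc
  have hi0 : PowerSeries.constantCoeff (h.substInvOfIsUnit h1) = 0 :=
    PowerSeries.constantCoeff_substInvOfIsUnit h h1
  have his := PowerSeries.HasSubst.of_constantCoeff_zero' hi0
  refine ⟨h, (h.substInvOfIsUnit h1).subst (F.mulSeries (p ^ v)), h0, h1,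
    PowerSeries.constantCoeff_subst_eq_zero hc _ hi0, ?_, ?_⟩
  · have hX : (g.expand (p ^ (n * v)) (NeZero.ne _)) =
        g.subst (PowerSeries.X ^ p ^ (n * v) : PowerSeries (IsLocalRing.ResidueField R)) :=
      PowerSeries.expand_apply _ _ _
    have e1 : PowerSeries.map (IsLocalRing.residue R)
        ((h.substInvOfIsUnit h1).subst (F.mulSeries (p ^ v))) =
        (PowerSeries.map (IsLocalRing.residue R) (h.substInvOfIsUnit h1)).subst
          (PowerSeries.map (IsLocalRing.residue R) (F.mulSeries (p ^ v))) :=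
      PowerSeries.map_subst hs' _
    have e2 := congrArg (PowerSeries.map (IsLocalRing.residue R))
      (PowerSeries.subst_substInvOfIsUnit_left h h0 h1)
    have h0s := PowerSeries.HasSubst.of_constantCoeff_zero' h0
    have e3 : PowerSeries.map (IsLocalRing.residue R) ((h.substInvOfIsUnit h1).subst h) =
        (PowerSeries.map (IsLocalRing.residue R) (h.substInvOfIsUnit h1)).subst g := by
      rw [← hmap]
      exact PowerSeries.map_subst h0s _
    rw [e3, PowerSeries.map_X] at e2
    have gs := PowerSeries.HasSubst.of_constantCoeff_zero' g0
    have hXs : PowerSeries.HasSubst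
        (PowerSeries.X ^ p ^ (n * v) : PowerSeries (IsLocalRing.ResidueField R)) :=
      PowerSeries.HasSubst.X_pow (NeZero.ne _)
    rw [e1, ← mulSeries_map, hg, hX, ← PowerSeries.subst_comp_subst_apply gs hXs, e2,
      PowerSeries.subst_X hXs]
  · rw [← PowerSeries.subst_comp_subst_apply his hs',
      PowerSeries.subst_substInvOfIsUnit_right h h0 h1, PowerSeries.subst_X hs']

lemma map_chern {S : Type*} [CommRing S] (F : FormalGroup R) (G : FormalGroup S) (f : R →+* S)
    (d : ℕ) (j : Fin d) : MvPowerSeries.map f (F.chern d j : MvPowerSeries (Fin d) R) =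
      G.chern d j := by
  change MvPowerSeries.map f ((divPoly R d).coeff (d - (j + 1))) =
    (divPoly S d).coeff (d - (j + 1))
  rw [← Polynomial.coeff_map, divPoly, Polynomial.map_prod]
  simp [divPoly]

lemma map_chernMap {S : Type*} [CommRing S] (F : FormalGroup R) (G : FormalGroup S) (f : R →+* S)
    (d : ℕ) (g : MvPowerSeries (Fin d) R) :
    MvPowerSeries.map f (F.chernMap d g : MvPowerSeries (Fin d) R) =
      G.chernMap d (MvPowerSeries.map f g) := by
  change MvPowerSeries.map f (substAlgHom (F.chern_hasSubst d) g) =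
    substAlgHom (G.chern_hasSubst d) (MvPowerSeries.map f g)
  rw [substAlgHom_apply, substAlgHom_apply, MvPowerSeries.map_subst (F.chern_hasSubst d)]
  simp_rw [F.map_chern G f]

lemma map_coordSeries {S : Type*} [CommRing S] (f : R →+* S) {φ : PowerSeries R} {M : ℕ}
    (hf : PowerSeries.map f φ = PowerSeries.X ^ M) (d : ℕ) (i : Fin d) :
    MvPowerSeries.map f (coordSeries φ d i) = X i ^ M := by
  rw [coordSeries, PowerSeries.map_subst (PowerSeries.HasSubst.X i), hf,
    MvPowerSeries.map_X, PowerSeries.subst_pow (PowerSeries.HasSubst.X i),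
    PowerSeries.subst_X (PowerSeries.HasSubst.X i)]

/-- In characteristic `p` the functions `c_j` are defined over the prime field, so that the
Frobenius `x_i ↦ x_i ^ (p ^ N)` raises them to the power `p ^ N`. -/
lemma expand_chern (p N d : ℕ) [ExpChar R p] (F : FormalGroup R) (j : Fin d) :
    MvPowerSeries.expand (p ^ N) (pow_ne_zero N (expChar_ne_zero R p))
      (F.chern d j : MvPowerSeries (Fin d) R) =
        (F.chern d j : MvPowerSeries (Fin d) R) ^ p ^ N := by
  rw [← map_iterateFrobenius_expand p (expChar_ne_zero R p), map_expand,
    F.map_chern F]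

/-- The equations of `Z(v, d)` as power series in the coordinates `c_j`. -/
lemma exists_chernMap_eq_pullDiv {K : Type*} [CommRing K] (F : FormalGroup R) (f : R →+* K)
    (p N d : ℕ) [ExpChar K p] {φ : PowerSeries R} (hφ : PowerSeries.constantCoeff φ = 0)
    (hf : PowerSeries.map f φ = PowerSeries.X ^ p ^ N) (j : Fin d) :
    ∃ g : MvPowerSeries (Fin d) R, F.chernMap d g = F.pullDiv hφ d (F.chern d j) ∧
      constantCoeff g = 0 ∧ MvPowerSeries.map f g = X j ^ p ^ N := by
  obtain ⟨g, hg⟩ := (F.chernMap_bijective d).2 (F.pullDiv hφ d (F.chern d j))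
  refine ⟨g, hg, ?_, ?_⟩
  · rw [← F.zeroDiv_chernMap, hg, zeroDiv_pullDiv, zeroDiv_chern]
  · refine ((F.map f).chernMap_bijective d).1 (Subtype.ext ?_)
    rw [← F.map_chernMap, hg, coe_pullDiv, seriesPull_apply,
      MvPowerSeries.map_subst (coordSeries_hasSubst hφ d)]
    simp_rw [map_coordSeries f hf]
    rw [F.map_chern (F.map f), map_pow, chernMap_X]
    refine Eq.trans ?_ (expand_chern p N d (F.map f) j)
    rw [MvPowerSeries.expand, substAlgHom_apply]

end Coordinates

end FormalGroup

/-! ### Finiteness, degree and the case of a field -/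

namespace FormalGroup

open MvPowerSeries

variable {R : Type*} [CommRing R]

/-- The coordinates `c_j` identify the functions on a closed subscheme of `Div_d^+(𝔾)` with a
quotient of `R⟦c_1, …, c_d⟧`. -/
def chernQuotientEquiv (F : FormalGroup R) (d : ℕ) {ι : Type*} (g : ι → MvPowerSeries (Fin d) R)
    (J : Ideal (F.divRing d)) (hJ : J = Ideal.span (Set.range fun j => F.chernMap d (g j))) :
    (MvPowerSeries (Fin d) R ⧸ Ideal.span (Set.range g)) ≃ₐ[R] F.divRing d ⧸ J :=
  Ideal.quotientEquivAlg _ _ (AlgEquiv.ofBijective (F.chernMap d) (F.chernMap_bijective d)) <| by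
    rw [hJ, Ideal.map_span, ← Set.range_comp]
    rfl

theorem finite_flat_finrank_zRing [IsLocalRing R] [IsNoetherianRing R]
    [IsAdicComplete (IsLocalRing.maximalIdeal R) R] (F : FormalGroup R) [F.IsComm] {p n : ℕ}
    [Fact p.Prime] (hn : 1 ≤ n) (hF : (F.map (IsLocalRing.residue R)).HasHeight p n) (v d : ℕ) :
    Module.Finite R (F.zRing p v d) ∧ Module.Flat R (F.zRing p v d) ∧
      Module.finrank R (F.zRing p v d) = p ^ (n * d * v) := by
  have := hF.charP hn
  obtain ⟨h, φ, h0, h1, hφ, hmap, hh⟩ := F.exists_mulSeries_eq_subst hn hF v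
  choose g hg g0 hgmap using
    F.exists_chernMap_eq_pullDiv (IsLocalRing.residue R) p (n * v) d hφ hmap
  obtain ⟨b, -⟩ := exists_basis_quotient_span (IsLocalRing.maximalIdeal R) g0 hgmap
  let b' : Module.Basis _ R (F.zRing p v d) := b.map (F.chernQuotientEquiv d g _ (by
    rw [F.zIdeal_eq_span p v d hφ h0 h1 hh]
    simp_rw [hg])).toLinearEquiv
  have hfree := Module.Free.of_basis b'
  refine ⟨Module.Finite.of_basis b', Module.Flat.of_free, ?_⟩
  rw [Module.finrank_eq_card_basis b']
  simp [← pow_mul, mul_right_comm]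

/-- The `c_j` generate the ideal of `d[0]`, and the relative Frobenius pulls them back to powers. -/
lemma relFrobFibreIdeal_eq_span (F : FormalGroup R) (p N d : ℕ) [ExpChar R p] :
    F.relFrobFibreIdeal p N d = Ideal.span (Set.range fun j => F.chern d j ^ p ^ N) := by
  have hchern : ∀ j, F.relFrob p N d ((F.frobTwist p N).chern d j) = F.chern d j ^ p ^ N :=
    fun j => Subtype.ext (F.expand_chern p N d j)
  refine le_antisymm ?_ ?_
  · refine Ideal.map_le_iff_le_comap.2 fun f hf => ?_
    obtain ⟨g, rfl⟩ := ((F.frobTwist p N).chernMap_bijective d).2 f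
    rw [RingHom.mem_ker, zeroDiv_chernMap] at hf
    obtain ⟨u, hu⟩ := (F.frobTwist p N).chernMap_eq_add d g
    rw [hu, hf, map_zero, _root_.zero_add, Ideal.mem_comap, map_sum]
    refine Ideal.sum_mem _ fun j _ => ?_
    rw [map_mul, hchern]
    exact Ideal.mul_mem_right _ _ (Ideal.subset_span ⟨j, rfl⟩)
  · refine Ideal.span_le.2 ?_
    rintro _ ⟨j, rfl⟩
    dsimp only
    rw [← hchern]
    exact Ideal.mem_map_of_mem _ (zeroDiv_chern _ d j)

/-- Over a field the series `φ` is the power `x ^ (p ^ (n * v))` itself, so that the equations of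
`Z(v, d)` are the `c_j ^ (p ^ (n * v))`. -/
theorem zIdeal_of_isField [IsLocalRing R] (F : FormalGroup R) [F.IsComm] {p n : ℕ}
    [Fact p.Prime] (hn : 1 ≤ n) (hF : (F.map (IsLocalRing.residue R)).HasHeight p n) (v d : ℕ)
    (hR : IsField R) : ∃ _ : CharP R p,
      F.zIdeal p v d = F.relFrobFibreIdeal p (n * v) d ∧
      Function.Surjective
        ((Ideal.Quotient.mkₐ R (F.zIdeal p v d)).comp (F.chernMap d)) ∧
      RingHom.ker ((Ideal.Quotient.mkₐ R (F.zIdeal p v d)).comp (F.chernMap d)) =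
        Ideal.span (Set.range fun j : Fin d =>
          (MvPowerSeries.X j : MvPowerSeries (Fin d) R) ^ p ^ (n * v)) := by
  have hinj : Function.Injective (IsLocalRing.residue R) := by
    let := hR.toField
    exact (IsLocalRing.residue R).injective
  have := hF.charP hn
  have hchar : CharP R p := (RingHom.charP_iff _ hinj p).2 this
  obtain ⟨h, φ, h0, h1, hφ, hmap, hh⟩ := F.exists_mulSeries_eq_subst hn hF v
  have hpull : ∀ j, F.pullDiv hφ d (F.chern d j) = F.chern d j ^ p ^ (n * v) := by
    intro j
    obtain ⟨g, hg, -, hgmap⟩ :=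
      F.exists_chernMap_eq_pullDiv (IsLocalRing.residue R) p (n * v) d hφ hmap j
    have : g = X j ^ p ^ (n * v) := by
      ext e
      refine hinj ?_
      rw [← coeff_map, ← coeff_map, hgmap, map_pow (MvPowerSeries.map (IsLocalRing.residue R)),
        MvPowerSeries.map_X]
    rw [← hg, this, map_pow, chernMap_X]
  have hz : F.zIdeal p v d = Ideal.span (Set.range fun j => F.chern d j ^ p ^ (n * v)) := by
    rw [F.zIdeal_eq_span p v d hφ h0 h1 hh]
    simp_rw [hpull]
  refine ⟨hchar, hz.trans (F.relFrobFibreIdeal_eq_span p (n * v) d).symm,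
    (Ideal.Quotient.mk_surjective).comp (F.chernMap_bijective d).2, ?_⟩
  have he : Ideal.span (Set.range fun j => F.chern d j ^ p ^ (n * v)) =
      (Ideal.span (Set.range fun j : Fin d =>
        (X j : MvPowerSeries (Fin d) R) ^ p ^ (n * v))).map (F.chernMap d) := by
    rw [Ideal.map_span, ← Set.range_comp]
    congr 2
    funext j
    rw [Function.comp_apply, map_pow, chernMap_X]
  ext f
  rw [RingHom.mem_ker, AlgHom.comp_apply, Ideal.Quotient.mkₐ_eq_mk, Ideal.Quotient.eq_zero_iff_mem,
    hz, he, ← Ideal.mem_comap, Ideal.comap_map_of_bijective _ (F.chernMap_bijective d)]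

end FormalGroup

/-! ### Tensor powers of `R⟦x⟧ / (ψ)` -/

section TensorPower

open MvPowerSeries FormalGroup

variable {R : Type*} [CommRing R]

lemma MvPowerSeries.monomial_finExponent {σ : Type*} [Fintype σ] {M : ℕ} (a : σ → Fin M) :
    monomial (finExponent a) (1 : R) = ∏ i, X i ^ (a i : ℕ) := by
  rw [monomial_one_eq, Finsupp.prod_fintype _ _ fun _ => pow_zero _]
  rfl

lemma MvPowerSeries.rename_monomial_finExponent {d M : ℕ} (σ : Equiv.Perm (Fin d))
    (a : Fin d → Fin M) : MvPowerSeries.rename σ (monomial (finExponent a) (1 : R)) =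
      monomial (finExponent fun i => a (σ.symm i)) 1 := by
  simp only [monomial_finExponent, map_prod, map_pow, rename_X]
  rw [← Equiv.prod_comp σ fun i => (X i : MvPowerSeries (Fin d) R) ^ (a (σ.symm i) : ℕ)]
  simp

/-- The case of one variable of `MvPowerSeries.exists_basis_quotient_span`. -/
lemma PowerSeries.exists_basis_quotient_span_singleton [IsNoetherianRing R] (I : Ideal R)
    [IsAdicComplete I R] {M : ℕ} [NeZero M] {ψ : PowerSeries R}
    (h0 : PowerSeries.constantCoeff ψ = 0)
    (hX : PowerSeries.map (Ideal.Quotient.mk I) ψ = PowerSeries.X ^ M) :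
    ∃ b : Module.Basis (Fin M) R (PowerSeries R ⧸ Ideal.span {ψ}),
      ∀ a, b a = Ideal.Quotient.mk _ (PowerSeries.X ^ (a : ℕ)) := by
  obtain ⟨b, hb⟩ := MvPowerSeries.exists_basis_quotient_span I (σ := Unit) (M := M)
    (f := fun _ => ψ) (fun _ => h0) fun _ => hX
  have hspan : Ideal.span (Set.range fun _ : Unit => ψ) = Ideal.span {ψ} := by
    rw [Set.range_const]
  refine ⟨(b.map (Ideal.quotientEquivAlgOfEq R hspan).toLinearEquiv).reindex
    (Equiv.funUnique Unit (Fin M)), fun a => ?_⟩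
  rw [Module.Basis.reindex_apply, Module.Basis.map_apply, hb, monomial_finExponent,
    Fintype.prod_unique]
  rfl

/-- The ring map `⨂ R⟦x⟧/K → R⟦x_1, …, x_d⟧/L` whose `i`-th component sends `g` to `g(x_i)`. -/
def tensorPowerToQuotient (d : ℕ) (K : Ideal (PowerSeries R))
    (L : Ideal (MvPowerSeries (Fin d) R)) (hKL : ∀ i, ∀ g ∈ K, coordSeries g d i ∈ L) :
    (⨂[R] _ : Fin d, (PowerSeries R ⧸ K)) →ₐ[R] MvPowerSeries (Fin d) R ⧸ L :=
  PiTensorProduct.liftAlgHom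
    ((MultilinearMap.mkPiAlgebra R (Fin d) (MvPowerSeries (Fin d) R ⧸ L)).compLinearMap fun i =>
      (Ideal.Quotient.liftₐ K ((Ideal.Quotient.mkₐ R L).comp
        (PowerSeries.substAlgHom (PowerSeries.HasSubst.X i))) fun g hg => by
          rw [AlgHom.comp_apply, PowerSeries.coe_substAlgHom]
          exact Ideal.Quotient.eq_zero_iff_mem.2 (hKL i g hg)).toLinearMap)
    (by simp) (by simp [Finset.prod_mul_distrib])

lemma tensorPowerToQuotient_tprod (d : ℕ) (K : Ideal (PowerSeries R))
    (L : Ideal (MvPowerSeries (Fin d) R)) (hKL : ∀ i, ∀ g ∈ K, coordSeries g d i ∈ L)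
    (g : Fin d → PowerSeries R) :
    tensorPowerToQuotient d K L hKL (PiTensorProduct.tprod R fun i => Ideal.Quotient.mk K (g i)) =
      Ideal.Quotient.mk L (∏ i, coordSeries (g i) d i) := by
  refine (PiTensorProduct.lift.tprod _).trans ?_
  rw [MultilinearMap.compLinearMap_apply, MultilinearMap.mkPiAlgebra_apply, map_prod]
  refine Finset.prod_congr rfl fun i _ => ?_
  change Ideal.Quotient.mk L (PowerSeries.substAlgHom (PowerSeries.HasSubst.X i) (g i)) = _
  rw [PowerSeries.coe_substAlgHom]

lemma tensorPowerToQuotient_singleAlgHom (d : ℕ) (K : Ideal (PowerSeries R))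
    (L : Ideal (MvPowerSeries (Fin d) R)) (hKL : ∀ i, ∀ g ∈ K, coordSeries g d i ∈ L)
    (i : Fin d) (g : PowerSeries R) :
    tensorPowerToQuotient d K L hKL (PiTensorProduct.singleAlgHom (R := R)
      (A := fun _ : Fin d => PowerSeries R ⧸ K) i (Ideal.Quotient.mk K g)) =
      Ideal.Quotient.mk L (coordSeries g d i) := by
  have h1 : (MonoidHom.mulSingle (fun _ : Fin d => PowerSeries R ⧸ K) i (Ideal.Quotient.mk K g)) =
      fun j => Ideal.Quotient.mk K (Pi.mulSingle (M := fun _ => PowerSeries R) i g j) := by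
    funext j
    rcases eq_or_ne j i with rfl | hj
    · simp
    · simp [Pi.mulSingle_eq_of_ne hj]
  rw [PiTensorProduct.singleAlgHom_apply, h1, tensorPowerToQuotient_tprod,
    Fintype.prod_eq_single i]
  · simp
  · intro j hj
    rw [Pi.mulSingle_eq_of_ne hj, coordSeries, ← PowerSeries.coe_substAlgHom
      (PowerSeries.HasSubst.X j), map_one]

lemma coordSeries_mem_span {d : ℕ} {ψ g : PowerSeries R} (hg : g ∈ Ideal.span {ψ}) (i : Fin d) :
    coordSeries g d i ∈ Ideal.span (Set.range (coordSeries ψ d)) := by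
  obtain ⟨u, rfl⟩ := Ideal.mem_span_singleton'.1 hg
  rw [coordSeries, PowerSeries.subst_mul (PowerSeries.HasSubst.X i)]
  exact Ideal.mul_mem_left _ _ (Ideal.subset_span ⟨i, rfl⟩)

/-- If `ψ` lifts a power of `x`, then the closed subscheme `Y` of `𝔾` cut out by `ψ` has the
expected powers: `Y^d` is cut out by the `ψ(x_i)` in `𝔾^d`. Both coordinate rings have bases of
monomials. The conditions on `ψ` are imposed only if `d ≠ 0`; for `d = 0` both rings are `R`. -/
theorem bijective_tensorPowerToQuotient [IsNoetherianRing R] (I : Ideal R) [IsAdicComplete I R]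
    {d M : ℕ} [NeZero M] {ψ : PowerSeries R} (h0 : Fin d → PowerSeries.constantCoeff ψ = 0)
    (hX : Fin d → PowerSeries.map (Ideal.Quotient.mk I) ψ = PowerSeries.X ^ M)
    {L : Ideal (MvPowerSeries (Fin d) R)} (hL : L = Ideal.span (Set.range (coordSeries ψ d)))
    (hKL : ∀ i, ∀ g ∈ Ideal.span {ψ}, coordSeries g d i ∈ L) :
    ∃ b : Module.Basis (Fin d → Fin M) R (MvPowerSeries (Fin d) R ⧸ L),
      (∀ a, b a = Ideal.Quotient.mk _ (monomial (finExponent a) 1)) ∧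
      Function.Bijective (tensorPowerToQuotient d (Ideal.span {ψ}) L hKL) := by
  subst hL
  obtain ⟨b, hb⟩ := MvPowerSeries.exists_basis_quotient_span I (M := M) (f := coordSeries ψ d)
    (fun i => constantCoeff_coordSeries (h0 i) d i) fun i => map_coordSeries _ (hX i) d i
  refine ⟨b, hb, ?_⟩
  choose c hc using fun i : Fin d =>
    PowerSeries.exists_basis_quotient_span_singleton I (h0 i) (hX i)
  let e := (Basis.piTensorProduct c).equiv b (Equiv.refl _)
  have he : e.toLinearMap = (tensorPowerToQuotient d (Ideal.span {ψ}) _ hKL).toLinearMap := by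
    refine (Basis.piTensorProduct c).ext fun a => ?_
    rw [LinearEquiv.coe_coe, Module.Basis.equiv_apply, Equiv.refl_apply, hb,
      Basis.piTensorProduct_apply, AlgHom.toLinearMap_apply]
    simp_rw [hc]
    rw [tensorPowerToQuotient_tprod, monomial_finExponent]
    congr 1
    refine Finset.prod_congr rfl fun i _ => ?_
    rw [coordSeries, PowerSeries.subst_pow (PowerSeries.HasSubst.X i),
      PowerSeries.subst_X (PowerSeries.HasSubst.X i)]
  have := e.bijective
  rw [← LinearEquiv.coe_coe, he] at this
  exact this

lemma tensorPowerToQuotient_reindex {d : ℕ} {K : Ideal (PowerSeries R)} {ψ : PowerSeries R}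
    {L : Ideal (MvPowerSeries (Fin d) R)} (hL : L = Ideal.span (Set.range (coordSeries ψ d)))
    (hKL : ∀ i, ∀ g ∈ K, coordSeries g d i ∈ L)
    (σ : Equiv.Perm (Fin d)) (t : ⨂[R] _ : Fin d, (PowerSeries R ⧸ K))
    (f : MvPowerSeries (Fin d) R) (hf : tensorPowerToQuotient d K L hKL t = Ideal.Quotient.mk _ f) :
    tensorPowerToQuotient d K L hKL (PiTensorProduct.reindex R (fun _ => PowerSeries R ⧸ K) σ t) =
      Ideal.Quotient.mk _ (MvPowerSeries.rename σ f) := by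
  have hσ : L ≤ L.comap (MvPowerSeries.rename σ : MvPowerSeries (Fin d) R →ₐ[R] _) := by
    subst hL
    refine Ideal.span_le.2 ?_
    rintro _ ⟨i, rfl⟩
    change MvPowerSeries.rename σ (coordSeries ψ d i) ∈ Ideal.span (Set.range (coordSeries ψ d))
    rw [rename_coordSeries]
    exact Ideal.subset_span ⟨_, rfl⟩
  let r := Ideal.quotientMapₐ L (MvPowerSeries.rename σ : MvPowerSeries (Fin d) R →ₐ[R] _) hσ
  have hr : (tensorPowerToQuotient d K L hKL).toLinearMap ∘ₗ
      (PiTensorProduct.reindex R (fun _ => PowerSeries R ⧸ K) σ).toLinearMap =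
      r.toLinearMap ∘ₗ (tensorPowerToQuotient d K L hKL).toLinearMap := by
    refine PiTensorProduct.ext (MultilinearMap.ext fun x => ?_)
    choose g hg using fun i => Ideal.Quotient.mk_surjective (I := K) (x i)
    obtain rfl : (fun i => Ideal.Quotient.mk K (g i)) = x := funext hg
    simp only [LinearMap.compMultilinearMap_apply, LinearMap.comp_apply, LinearEquiv.coe_coe,
      PiTensorProduct.reindex_tprod, AlgHom.toLinearMap_apply]
    rw [tensorPowerToQuotient_tprod d K L hKL fun i => g (σ.symm i),
      tensorPowerToQuotient_tprod d K L hKL]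
    change _ = Ideal.Quotient.mk _ (MvPowerSeries.rename σ _)
    rw [map_prod (MvPowerSeries.rename σ)]
    simp_rw [rename_coordSeries]
    rw [← Equiv.prod_comp σ]
    simp
  refine (LinearMap.congr_fun hr t).trans ?_
  rw [LinearMap.comp_apply, AlgHom.toLinearMap_apply, AlgHom.toLinearMap_apply, hf]
  rfl

/-- The ring map of `Y^d → 𝔾^d` and of `Y^d/Σ_d → Div_d^+(𝔾)`, where `Y` is the closed subscheme of
`𝔾` cut out by a lift `ψ` of a power of `x`. Surjectivity on symmetric tensors holds since the
monomials give a linear section that commutes with the permutations. -/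
theorem exists_powerOfInclusion [IsNoetherianRing R] (I : Ideal R) [IsAdicComplete I R]
    {d M : ℕ} [NeZero M] {ψ : PowerSeries R} (h0 : Fin d → PowerSeries.constantCoeff ψ = 0)
    (hX : Fin d → PowerSeries.map (Ideal.Quotient.mk I) ψ = PowerSeries.X ^ M)
    {K : Ideal (PowerSeries R)} (hK : K = Ideal.span {ψ}) (F : FormalGroup R) :
    ∃ θ : MvPowerSeries (Fin d) R →ₐ[R] ⨂[R] _ : Fin d, (PowerSeries R ⧸ K),
      IsPowerOfInclusion K d θ ∧ (∀ θ', IsPowerOfInclusion K d θ' → θ' = θ) ∧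
      RingHom.ker θ = Ideal.span (Set.range (coordSeries ψ d)) ∧
      ∃ k : F.divRing d →ₐ[R] symTensors R (PowerSeries R ⧸ K) d,
        (∀ f, (k f).val = θ f.val) ∧ Function.Surjective k := by
  subst hK
  obtain ⟨L, hL⟩ : ∃ L, L = Ideal.span (Set.range (coordSeries ψ d)) := ⟨_, rfl⟩
  have hKL : ∀ i, ∀ g ∈ Ideal.span {ψ}, coordSeries g d i ∈ L :=
    fun i g hg => hL ▸ coordSeries_mem_span hg i
  obtain ⟨b, hb, hbij⟩ := bijective_tensorPowerToQuotient I h0 hX hL hKL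
  let κ := tensorPowerToQuotient d (Ideal.span {ψ}) L hKL
  let e := AlgEquiv.ofBijective κ hbij
  let θ : MvPowerSeries (Fin d) R →ₐ[R] ⨂[R] _ : Fin d, (PowerSeries R ⧸ Ideal.span {ψ}) :=
    e.symm.toAlgHom.comp (Ideal.Quotient.mkₐ R L)
  have hκθ : ∀ f, κ (θ f) = Ideal.Quotient.mk L f := fun f => e.apply_symm_apply _
  have hker : RingHom.ker θ = L := by
    ext f
    rw [RingHom.mem_ker, ← Ideal.Quotient.eq_zero_iff_mem, ← hκθ]
    exact ⟨fun h => by rw [h, map_zero], fun h => hbij.1 (by rw [h, map_zero])⟩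
  have hθ : IsPowerOfInclusion (Ideal.span {ψ}) d θ := fun i g => hbij.1 <| by
    rw [hκθ]
    exact (tensorPowerToQuotient_singleAlgHom d _ L hKL i g).symm
  have hreindex : ∀ (σ : Equiv.Perm (Fin d)) f,
      PiTensorProduct.reindex R (fun _ => PowerSeries R ⧸ Ideal.span {ψ}) σ (θ f) =
        θ (MvPowerSeries.rename σ f) := fun σ f => hbij.1 <| by
    rw [hκθ]
    exact tensorPowerToQuotient_reindex hL hKL σ _ _ (hκθ f)
  refine ⟨θ, hθ, fun θ' hθ' => ?_, hker.trans hL,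
    (θ.comp (F.divRing d).val).codRestrict _ fun f σ => ?_, fun f => rfl, ?_⟩
  · have hX' : ∀ i, θ' (X i) = θ (X i) := fun i => by
      have h1 := hθ' i PowerSeries.X
      have h2 := hθ i PowerSeries.X
      rw [PowerSeries.subst_X (PowerSeries.HasSubst.X i)] at h1 h2
      rw [h1, h2]
    have hL' : ∀ f ∈ L, θ' f = 0 := fun f hf => by
      rw [hL] at hf
      refine (Ideal.span_le (I := RingHom.ker θ')).2 ?_ hf
      rintro _ ⟨i, rfl⟩
      change θ' _ = 0
      rw [hθ' i ψ, Ideal.Quotient.eq_zero_iff_mem.2 (Ideal.mem_span_singleton_self ψ), map_zero]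
    have hlin : (Ideal.Quotient.liftₐ L θ' hL').toLinearMap = e.symm.toLinearMap := by
      refine b.ext fun a => ?_
      rw [hb]
      change θ' _ = θ _
      rw [monomial_finExponent]
      exact Subalgebra.prod_mem (AlgHom.equalizer θ' θ) fun i _ => Subalgebra.pow_mem _ (hX' i) _
    exact AlgHom.ext fun f => LinearMap.congr_fun hlin (Ideal.Quotient.mk L f)
  · change PiTensorProduct.reindex R _ σ (θ f) = θ f
    rw [hreindex]
    exact congrArg θ (f.2 σ)
  · let c := b.map e.symm.toLinearEquiv
    have hc : ∀ a, c a = θ (monomial (finExponent a) 1) := fun a => by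
      rw [Module.Basis.map_apply, hb]
      rfl
    let s := c.constr R fun a => (monomial (finExponent a) (1 : R) : MvPowerSeries (Fin d) R)
    have hs : ∀ a, s (c a) = monomial (finExponent a) 1 := fun a => c.constr_basis R _ a
    have hθs : θ.toLinearMap ∘ₗ s = LinearMap.id := c.ext fun a => by
      rw [LinearMap.comp_apply, hs, LinearMap.id_apply, hc]
      rfl
    have hσs : ∀ σ : Equiv.Perm (Fin d), s ∘ₗ
        (PiTensorProduct.reindex R (fun _ => PowerSeries R ⧸ Ideal.span {ψ}) σ).toLinearMap =
        (MvPowerSeries.rename σ : MvPowerSeries (Fin d) R →ₐ[R] _).toLinearMap ∘ₗ s := by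
      refine fun σ => c.ext fun a => ?_
      rw [LinearMap.comp_apply, LinearMap.comp_apply, hs, LinearEquiv.coe_coe, hc, hreindex,
        AlgHom.toLinearMap_apply, rename_monomial_finExponent, ← hc, hs]
    intro t
    refine ⟨⟨s t, fun σ => ?_⟩, Subtype.ext (LinearMap.congr_fun hθs t)⟩
    refine (LinearMap.congr_fun (hσs σ) t).symm.trans ?_
    rw [LinearMap.comp_apply]
    exact congrArg s (t.2 σ)

end TensorPower

/-! ### The infinitesimal thickenings -/

section Quotient

variable {R S A₁ A₂ : Type*} [CommRing R] [CommRing S] [CommRing A₁] [CommRing A₂] [Algebra R S]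
  [Algebra R A₁] [Algebra R A₂]

/-- If an ideal `J` lies between the kernels of two quotient maps and these three ideals have the
same radical, then the quotient by `J` lies between the two quotients as an infinitesimal
thickening. -/
lemma Ideal.exists_algHom_quotient_of_between [IsNoetherianRing R] (J : Ideal S)
    [Module.Finite R (S ⧸ J)] (hfg : J.FG) {k₁ : S →ₐ[R] A₁} {k₂ : S →ₐ[R] A₂}
    (hs₁ : Function.Surjective k₁) (hs₂ : Function.Surjective k₂)
    (hJ₁ : ∀ f ∈ J, k₁ f = 0) (hJ₂ : ∀ f, k₂ f = 0 → f ∈ J)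
    (hn₁ : ∀ f, k₁ f = 0 → ∃ m, f ^ m ∈ J) (hn₂ : ∀ f ∈ J, ∃ m, k₂ (f ^ m) = 0) :
    ∃ (j : A₂ →ₐ[R] S ⧸ J) (i : S ⧸ J →ₐ[R] A₁), (∀ f, j (k₂ f) = Ideal.Quotient.mk J f) ∧
      (∀ f, i (Ideal.Quotient.mk J f) = k₁ f) ∧ Function.Surjective j ∧ Function.Surjective i ∧
      IsNilpotent (RingHom.ker i) ∧ IsNilpotent (RingHom.ker j) := by
  let i := Ideal.Quotient.liftₐ J k₁ hJ₁
  let l := Ideal.Quotient.liftₐ (RingHom.ker k₂) (Ideal.Quotient.mkₐ R J)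
    fun f hf => Ideal.Quotient.eq_zero_iff_mem.2 (hJ₂ f hf)
  let j := l.comp (Ideal.quotientKerAlgEquivOfSurjective hs₂).symm.toAlgHom
  have hjk : ∀ f, j (k₂ f) = Ideal.Quotient.mk J f := fun f => by
    have : (Ideal.quotientKerAlgEquivOfSurjective hs₂).symm (k₂ f) =
        Ideal.Quotient.mk (RingHom.ker k₂) f := by
      rw [AlgEquiv.symm_apply_eq]
      rfl
    exact congrArg l this
  have hik : ∀ f, i (Ideal.Quotient.mk J f) = k₁ f := fun f => rfl
  refine ⟨j, i, hjk, hik, fun z => ?_, fun t => ?_, ?_, ?_⟩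
  · obtain ⟨f, rfl⟩ := Ideal.Quotient.mk_surjective z
    exact ⟨k₂ f, hjk f⟩
  · obtain ⟨f, rfl⟩ := hs₁ t
    exact ⟨_, hik f⟩
  · have : IsNoetherianRing (S ⧸ J) := IsNoetherianRing.of_finite R _
    rw [Ideal.FG.isNilpotent_iff_le_nilradical (IsNoetherian.noetherian _)]
    intro z hz
    obtain ⟨f, rfl⟩ := Ideal.Quotient.mk_surjective z
    rw [RingHom.mem_ker, hik] at hz
    obtain ⟨m, hm⟩ := hn₁ f hz
    exact ⟨m, by rw [← map_pow, Ideal.Quotient.eq_zero_iff_mem.2 hm]; exact Ideal.zero_mem _⟩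
  · have hkerj : RingHom.ker j = J.map k₂ := by
      refine le_antisymm (fun t ht => ?_) (Ideal.map_le_iff_le_comap.2 fun f hf => ?_)
      · obtain ⟨f, rfl⟩ := hs₂ t
        rw [RingHom.mem_ker, hjk, Ideal.Quotient.eq_zero_iff_mem] at ht
        exact Ideal.mem_map_of_mem _ ht
      · rw [Ideal.mem_comap, RingHom.mem_ker, hjk, Ideal.Quotient.eq_zero_iff_mem]
        exact hf
    have hfgj : (RingHom.ker j).FG := by
      rw [hkerj]
      exact hfg.map k₂.toRingHom
    rw [Ideal.FG.isNilpotent_iff_le_nilradical hfgj]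
    intro t ht
    obtain ⟨f, rfl⟩ := hs₂ t
    rw [RingHom.mem_ker, hjk, Ideal.Quotient.eq_zero_iff_mem] at ht
    obtain ⟨m, hm⟩ := hn₂ f ht
    exact ⟨m, by rw [← map_pow, hm]; exact Ideal.zero_mem _⟩

end Quotient

namespace FormalGroup

open MvPowerSeries

section Thickening

variable {R : Type*} [CommRing R]

/-- Each `b_i` is a root of `∏ l, (t - b_l)`, so that `b_i ^ d` lies in every ideal containing the
lower coefficients of this polynomial. -/
lemma pow_mem_of_aeval_chernPoly_mem {A : Type*} [CommRing A] [Algebra R A] {d : ℕ} (b : Fin d → A)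
    {J : Ideal A} (hJ : ∀ j, MvPolynomial.aeval b (chernPoly R d j) ∈ J) (i : Fin d) :
    b i ^ d ∈ J := by
  rcases subsingleton_or_nontrivial A with hA | hA
  · exact Subsingleton.elim 0 (b i ^ d) ▸ J.zero_mem
  set P : Polynomial A := ∏ l, (Polynomial.X - Polynomial.C (b l)) with hP
  have hdeg : P.natDegree = d := by simp [hP]
  have hmonic : P.Monic := Polynomial.monic_prod_of_monic _ _ fun l _ => Polynomial.monic_X_sub_C _
  have heval : P.eval (b i) = 0 := by
    rw [hP, Polynomial.eval_prod]
    exact Finset.prod_eq_zero (Finset.mem_univ i) (by simp)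
  rw [Polynomial.eval_eq_sum_range, hdeg, Finset.sum_range_succ] at heval
  have hlead : P.coeff d = 1 := by rw [← hdeg]; exact hmonic.coeff_natDegree
  rw [hlead, one_mul] at heval
  rw [eq_neg_of_add_eq_zero_right heval]
  refine J.neg_mem (Ideal.sum_mem _ fun k hk => J.mul_mem_right _ ?_)
  have hk' := Finset.mem_range.1 hk
  have hj := coeff_prod_X_sub_C (R := R) b ⟨d - (k + 1), by omega⟩
  have hkd : d - (d - (k + 1) + 1) = k := by omega
  dsimp only at hj
  rw [hkd] at hj
  rw [hP, hj]
  exact hJ _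

variable {φ : PowerSeries R}

lemma coe_pullDiv_chern (F : FormalGroup R) (hφ : PowerSeries.constantCoeff φ = 0) (d : ℕ)
    (j : Fin d) : (F.pullDiv hφ d (F.chern d j) : MvPowerSeries (Fin d) R) =
      MvPolynomial.aeval (coordSeries φ d) (chernPoly R d j) := by
  rw [coe_pullDiv, chern_coe, seriesPull_apply, subst_coe]

/-- The inclusion of `Y^d/Σ_d`, for `Y` cut out by `φ`, in the scheme of the divisors `D` with
`φ_* D = d[0]`: functions vanishing on the latter vanish on the former. -/
lemma coe_mem_span_coordSeries (F : FormalGroup R) (hφ : PowerSeries.constantCoeff φ = 0) (d : ℕ)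
    {f : F.divRing d}
    (hf : f ∈ Ideal.span (Set.range fun j => F.pullDiv hφ d (F.chern d j))) :
    (f : MvPowerSeries (Fin d) R) ∈ Ideal.span (Set.range (coordSeries φ d)) := by
  refine (Ideal.span_le (I := (Ideal.span (Set.range (coordSeries φ d))).comap
    (F.divRing d).val)).2 ?_ hf
  rintro _ ⟨j, rfl⟩
  change (F.pullDiv hφ d (F.chern d j) : MvPowerSeries (Fin d) R) ∈
    Ideal.span (Set.range (coordSeries φ d))
  have h := subst_sub_C_mem_span (coordSeries_hasSubst hφ d)
    (F.chern d j : MvPowerSeries (Fin d) R)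
  have h0 : constantCoeff (F.chern d j : MvPowerSeries (Fin d) R) = 0 := F.zeroDiv_chern d j
  rwa [h0, map_zero, sub_zero, ← seriesPull_apply hφ] at h

lemma coordSeries_pow_mem_map (F : FormalGroup R) (hφ : PowerSeries.constantCoeff φ = 0) (d : ℕ)
    (i : Fin d) : coordSeries φ d i ^ d ∈
      (Ideal.span (Set.range fun j => F.pullDiv hφ d (F.chern d j))).map
        (algebraMap (F.divRing d) (MvPowerSeries (Fin d) R)) :=
  pow_mem_of_aeval_chernPoly_mem (R := R) _ (fun j => by
    rw [← F.coe_pullDiv_chern hφ]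
    exact Ideal.mem_map_of_mem (algebraMap (F.divRing d) (MvPowerSeries (Fin d) R))
      (Ideal.subset_span (Set.mem_range_self j))) i

/-- An invariant in the ideal of the `φ(x_i) ^ d` vanishes on the scheme of the divisors `D` with
`φ_* D = d[0]`. This needs that the invariants are a direct summand of `R⟦x_1, …, x_d⟧`. -/
lemma mem_span_pullDiv (F : FormalGroup R) (hφ : PowerSeries.constantCoeff φ = 0) (d : ℕ)
    {f : F.divRing d} (hf : (f : MvPowerSeries (Fin d) R) ∈
      Ideal.span (Set.range fun i => coordSeries φ d i ^ d)) :
    f ∈ Ideal.span (Set.range fun j => F.pullDiv hφ d (F.chern d j)) := by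
  obtain ⟨ρ, hρ⟩ := F.exists_retraction d
  refine Ideal.mem_of_algebraMap_mem_map ρ hρ (Ideal.span_le.2 ?_ hf)
  rintro _ ⟨i, rfl⟩
  exact F.coordSeries_pow_mem_map hφ d i

/-- Functions vanishing on `Y^d/Σ_d`, for `Y` cut out by `φ`, are nilpotent on the scheme of the
divisors `D` with `φ_* D = d[0]`. -/
lemma exists_pow_mem_span_pullDiv (F : FormalGroup R) (hφ : PowerSeries.constantCoeff φ = 0)
    (d : ℕ) {f : F.divRing d}
    (hf : (f : MvPowerSeries (Fin d) R) ∈ Ideal.span (Set.range (coordSeries φ d))) :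
    ∃ m, f ^ m ∈ Ideal.span (Set.range fun j => F.pullDiv hφ d (F.chern d j)) := by
  obtain ⟨ρ, hρ⟩ := F.exists_retraction d
  have hrad : Ideal.span (Set.range (coordSeries φ d)) ≤
      ((Ideal.span (Set.range fun j => F.pullDiv hφ d (F.chern d j))).map
        (algebraMap (F.divRing d) (MvPowerSeries (Fin d) R))).radical := by
    refine Ideal.span_le.2 ?_
    rintro _ ⟨i, rfl⟩
    exact ⟨d, F.coordSeries_pow_mem_map hφ d i⟩
  obtain ⟨m, hm⟩ := hrad hf
  exact ⟨m, Ideal.mem_of_algebraMap_mem_map ρ hρ hm⟩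

/-- An invertible series without constant term is a unit times the variable. -/
lemma span_singleton_subst_eq {h ψ : PowerSeries R} (hφ : PowerSeries.constantCoeff φ = 0)
    (h0 : PowerSeries.constantCoeff h = 0) (h1 : IsUnit (PowerSeries.coeff 1 h))
    (hψ : ψ = h.subst φ) : Ideal.span {ψ} = Ideal.span {φ} := by
  obtain ⟨u, rfl⟩ := PowerSeries.X_dvd_iff.2 h0
  have hs := PowerSeries.HasSubst.of_constantCoeff_zero' hφ
  have hu : IsUnit u := by
    rw [PowerSeries.isUnit_iff_constantCoeff, ← PowerSeries.coeff_zero_eq_constantCoeff_apply]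
    rwa [← PowerSeries.coeff_succ_X_mul]
  rw [hψ, PowerSeries.subst_mul hs, PowerSeries.subst_X hs, ← PowerSeries.coe_substAlgHom hs]
  exact Ideal.span_singleton_mul_right_unit (hu.map _) _

/-- The map `k` is onto with kernel the invariants in the ideal of the `φ(x_i) ^ d`, and the
composite of `i` with the projection is onto with kernel the invariants in the ideal of the
`φ(x_i)`; the ideal of `Z(v, d)` lies between the two. -/
theorem exists_thickenings [IsLocalRing R] [IsNoetherianRing R]
    [IsAdicComplete (IsLocalRing.maximalIdeal R) R] (F : FormalGroup R) [F.IsComm] {p n : ℕ}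
    [Fact p.Prime] (hn : 1 ≤ n) (hF : (F.map (IsLocalRing.residue R)).HasHeight p n) (v d : ℕ) :
    ∃ (θ₁ : MvPowerSeries (Fin d) R →ₐ[R]
            PiTensorProduct R (fun _ : Fin d => PowerSeries R ⧸ F.torsionIdeal p v))
        (θ₂ : MvPowerSeries (Fin d) R →ₐ[R]
            PiTensorProduct R (fun _ : Fin d => PowerSeries R ⧸ F.torsionIdeal p v ^ d)),
      IsPowerOfInclusion (F.torsionIdeal p v) d θ₁ ∧
      (∀ θ, IsPowerOfInclusion (F.torsionIdeal p v) d θ → θ = θ₁) ∧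
      IsPowerOfInclusion (F.torsionIdeal p v ^ d) d θ₂ ∧
      (∀ θ, IsPowerOfInclusion (F.torsionIdeal p v ^ d) d θ → θ = θ₂) ∧
      ∃ (k : F.divRing d →ₐ[R] symTensors R (PowerSeries R ⧸ F.torsionIdeal p v ^ d) d)
        (j : symTensors R (PowerSeries R ⧸ F.torsionIdeal p v ^ d) d →ₐ[R] F.zRing p v d)
        (i : F.zRing p v d →ₐ[R] symTensors R (PowerSeries R ⧸ F.torsionIdeal p v) d),
        (∀ f : F.divRing d, (k f).val = θ₂ f.val) ∧
        (∀ f : F.divRing d, j (k f) = Ideal.Quotient.mk (F.zIdeal p v d) f) ∧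
        (∀ f : F.divRing d, (i (Ideal.Quotient.mk (F.zIdeal p v d) f)).val = θ₁ f.val) ∧
        Function.Surjective k ∧ Function.Surjective j ∧ Function.Surjective i ∧
        IsNilpotent (RingHom.ker i) ∧ IsNilpotent (RingHom.ker j) := by
  obtain ⟨h, φ, h0, h1, hφ, hmap, hh⟩ := F.exists_mulSeries_eq_subst hn hF v
  have hK : F.torsionIdeal p v = Ideal.span {φ} := span_singleton_subst_eq hφ h0 h1 hh
  have hKd : F.torsionIdeal p v ^ d = Ideal.span {φ ^ d} := by
    rw [hK, Ideal.span_singleton_pow]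
  have hJ := F.zIdeal_eq_span p v d hφ h0 h1 hh
  have hfin := (F.finite_flat_finrank_zRing hn hF v d).1
  obtain ⟨θ₁, hθ₁, hu₁, hker₁, k₁, hk₁, hs₁⟩ := exists_powerOfInclusion
    (IsLocalRing.maximalIdeal R) (d := d) (fun _ => hφ) (fun _ => hmap) hK F
  -- If `d = 0` there are no coordinates, and any positive exponent will do in place of `0`.
  obtain ⟨θ₂, hθ₂, hu₂, hker₂, k, hk, hs⟩ := exists_powerOfInclusion
    (IsLocalRing.maximalIdeal R) (d := d) (M := p ^ (n * v) * (d - 1 + 1)) (ψ := φ ^ d)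
    (fun a => by rw [map_pow, hφ, zero_pow (Fin.pos a).ne'])
    (fun a => by
      have : d - 1 + 1 = d := Nat.sub_add_cancel (Fin.pos a)
      rw [map_pow, pow_mul, this]
      exact congrArg (· ^ d) hmap) hKd F
  have hpow : coordSeries (φ ^ d) d = fun i => coordSeries φ d i ^ d :=
    funext fun i => PowerSeries.subst_pow (PowerSeries.HasSubst.X i) _ _
  have hkerk : ∀ f, k f = 0 ↔ (f : MvPowerSeries (Fin d) R) ∈
      Ideal.span (Set.range fun i => coordSeries φ d i ^ d) := fun f => by
    rw [← hpow, ← hker₂, RingHom.mem_ker, ← hk, Subtype.ext_iff]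
    rfl
  have hkerk₁ : ∀ f, k₁ f = 0 ↔ (f : MvPowerSeries (Fin d) R) ∈
      Ideal.span (Set.range (coordSeries φ d)) := fun f => by
    rw [← hker₁, RingHom.mem_ker, ← hk₁, Subtype.ext_iff]
    rfl
  obtain ⟨j, i, hjk, hik, hjs, his, hin, hjn⟩ := Ideal.exists_algHom_quotient_of_between
    (F.zIdeal p v d) (by
      rw [hJ]
      exact Submodule.fg_span (Set.finite_range _)) hs₁ hs
    (fun f hf => (hkerk₁ f).2 (F.coe_mem_span_coordSeries hφ d (hJ ▸ hf)))
    (fun f hf => by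
      rw [hJ]
      exact F.mem_span_pullDiv hφ d ((hkerk f).1 hf))
    (fun f hf => by
      rw [hJ]
      exact F.exists_pow_mem_span_pullDiv hφ d ((hkerk₁ f).1 hf))
    (fun f hf => by
      rw [hJ] at hf
      have hrad : Ideal.span (Set.range (coordSeries φ d)) ≤
          (Ideal.span (Set.range fun i => coordSeries φ d i ^ d)).radical := by
        refine Ideal.span_le.2 ?_
        rintro _ ⟨i, rfl⟩
        exact ⟨d, Ideal.subset_span ⟨i, rfl⟩⟩
      obtain ⟨m, hm⟩ := hrad (F.coe_mem_span_coordSeries hφ d hf)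
      exact ⟨m, (hkerk _).2 hm⟩)
  exact ⟨θ₁, θ₂, hθ₁, hu₁, hθ₂, hu₂, k, j, i, hk, hjk,
    fun f => (congrArg Subtype.val (hik f)).trans (hk₁ f), hs, hjs, his, hin, hjn⟩

end Thickening

end FormalGroup

end

theorem mainTheorem3 {R : Type*} [CommRing R] [IsLocalRing R] [IsNoetherianRing R]
    [IsAdicComplete (IsLocalRing.maximalIdeal R) R]
    (p : ℕ) [Fact p.Prime] (n : ℕ) (hn : 1 ≤ n)
    (F : FormalGroup R) [F.IsComm]
    (hF : (F.map (IsLocalRing.residue R)).HasHeight p n) (v d : ℕ) :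
    -- `Z(v, d)` is finite and flat over the base, of degree `p ^ (n * d * v)`
    (Module.Finite R (F.zRing p v d) ∧ Module.Flat R (F.zRing p v d) ∧
      Module.finrank R (F.zRing p v d) = p ^ (n * d * v)) ∧
    -- the closed inclusions `𝔾(v)^d/Σ_d → Z(v, d) → 𝔾(v, d)^d/Σ_d → Div_d^+(𝔾)`
    (∃ (θ₁ : MvPowerSeries (Fin d) R →ₐ[R]
            PiTensorProduct R (fun _ : Fin d => PowerSeries R ⧸ F.torsionIdeal p v))
        (θ₂ : MvPowerSeries (Fin d) R →ₐ[R]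
            PiTensorProduct R (fun _ : Fin d => PowerSeries R ⧸ F.torsionIdeal p v ^ d)),
      IsPowerOfInclusion (F.torsionIdeal p v) d θ₁ ∧
      (∀ θ, IsPowerOfInclusion (F.torsionIdeal p v) d θ → θ = θ₁) ∧
      IsPowerOfInclusion (F.torsionIdeal p v ^ d) d θ₂ ∧
      (∀ θ, IsPowerOfInclusion (F.torsionIdeal p v ^ d) d θ → θ = θ₂) ∧
      ∃ (k : F.divRing d →ₐ[R] symTensors R (PowerSeries R ⧸ F.torsionIdeal p v ^ d) d)
        (j : symTensors R (PowerSeries R ⧸ F.torsionIdeal p v ^ d) d →ₐ[R] F.zRing p v d)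
        (i : F.zRing p v d →ₐ[R] symTensors R (PowerSeries R ⧸ F.torsionIdeal p v) d),
        -- these are maps over `Div_d^+(𝔾)`
        (∀ f : F.divRing d, (k f).val = θ₂ f.val) ∧
        (∀ f : F.divRing d, j (k f) = Ideal.Quotient.mk (F.zIdeal p v d) f) ∧
        (∀ f : F.divRing d, (i (Ideal.Quotient.mk (F.zIdeal p v d) f)).val = θ₁ f.val) ∧
        Function.Surjective k ∧ Function.Surjective j ∧ Function.Surjective i ∧
        -- the first two are infinitesimal thickenings
        IsNilpotent (RingHom.ker i) ∧ IsNilpotent (RingHom.ker j)) ∧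
    -- the case where the base is a field
    (IsField R → ∃ _ : CharP R p,
      F.zIdeal p v d = F.relFrobFibreIdeal p (n * v) d ∧
      Function.Surjective
        ((Ideal.Quotient.mkₐ R (F.zIdeal p v d)).comp (F.chernMap d)) ∧
      RingHom.ker ((Ideal.Quotient.mkₐ R (F.zIdeal p v d)).comp (F.chernMap d)) =
        Ideal.span (Set.range fun j : Fin d =>
          (MvPowerSeries.X j : MvPowerSeries (Fin d) R) ^ p ^ (n * v))) :=
  ⟨F.finite_flat_finrank_zRing hn hF v d, F.exists_thickenings hn hF v d,
    F.zIdeal_of_isField hn hF v d⟩
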